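/- Let $k$ be a field and $s\ge 1$. Let $A_2 = (x\to y)$, and let $N_s(A_2)$ be the nilpotent quiver algebra: the path algebra over $k$ (paths composed from right to left) of the quiver with vertices $x_t,y_t$ ($1\le t\le s$) and arrows $b\colon x_t\to x_{t+1}$, $b\colon y_t\to y_{t+1}$ ($1\le t<s$) and $a_t\colon x_t\to y_{t-1}$ ($2\le t\le s$), modulo the relations $a_{t+1}b(x_t)=b(y_{t-1})a_t$ ($1<t<s$) and $a_2b(x_1)=0$. Modules are finite-dimensional left modules. A vertex with index $t$ has layer $t$. For a vertex $v$ let $P(v)=N_s(A_2)e_v$ be the indecomposable projective with simple top $S(v)$, and let the standard module $\Delta(v)$ be the maximal factor module of $P(v)$ such that all composition factors of its radical lie in layers strictly greater than that of $v$. A module is $\Delta$-filtered if it has a finite filtration by submodules with all successive quotients standard modules; $M$ is rigid if $\mathrm{Ext}^1(M,M)=0$; $[M]=(\dim_k e_vM)_v$ is the dimension vector. A dimension filtration is a vector $\mathbf d=(d_{x}^{(t)},d_{y}^{(t)})_{1\le t\le s}$ of non-negative integers with $d_x^{(t)}\le d_x^{(t+1)}$ and $d_y^{(t)}\le d_y^{(t+1)}$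 for $1\le t<s$; it is regarded as a dimension vector for $N_s(A_2)$. (0) For $1\le j<i\le s$ there is, up to isomorphism, exactly one indecomposable $\Delta$-filtered module $E(i,j)$ with $[E(i,j)]=[\Delta(x_i)]+[\Delta(y_j)]$. Let $\mathbf d$ be any dimension filtration. (1) There are unique non-negative integers $\hat x_1,\dots,\hat x_s,\hat y_1,\dots,\hat y_s$ with $\mathbf d=\sum_i\hat x_i[\Delta(x_i)]+\sum_j\hat y_j[\Delta(y_j)]$. (2) Start with $M=0$ and these integers, and execute the following steps. (i) If all $\hat x_i$ are $0$, go to (iii). Otherwise let $i$ be minimal with $\hat x_i\ne 0$ and go to (ii). (ii) If $\hat y_j=0$ for all $j<i$, replace $M$ by $M\oplus\Delta(x_i)$ and $\hat x_i$ by $\hat x_i-1$. Otherwise let $j$ be maximal with $j<i$ and $\hat y_j\neq 0$; replace $M$ by $M\oplus E(i,j)$, $\hat x_i$ by $\hat x_i-1$ and $\hat y_j$ by $\hat y_j-1$. Go back to (i). (iii) Return $M\oplus\bigoplus_{j=1}^s\Delta(y_j)^{\hat y_j}$. This terminates, and the module returned is a finite-dimensional rigid $\Delta$-filtered $N_s(A_2)$-module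 of dimension vector $\mathbf d$. (3) If $k$ is algebraically closed, then there is a Richardson orbit for $(A_2,\mathbf d)$: for all flags $F_c^{(1)}\subseteq\dots\subseteq F_c^{(s)}=k^{d_c^{(s)}}$ with $\dim F_c^{(t)}=d_c^{(t)}$ ($c\in\{x,y\}$), $F_c^{(0)}=0$, the group of all pairs $(g,h)\in GL_{d_x^{(s)}}(k)\times GL_{d_y^{(s)}}(k)$ with $gF_x^{(t)}\subseteq F_x^{(t)}$ and $hF_y^{(t)}\subseteq F_y^{(t)}$ for all $t$, acting by $(g,h)\cdot M=hMg^{-1}$, has a Zariski-dense orbit in the space of all linear maps $M\colon k^{d_x^{(s)}}\to k^{d_y^{(s)}}$ with $M(F_x^{(t)})\subseteq F_y^{(t-1)}$ for $1\le t\le s$. -/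

import Mathlib

open CategoryTheory

universe u

namespace NilpA2

/-- The vertices of the quiver `A₂ : x ⟶ y`. -/
inductive A2 : Type
  | x : A2
  | y : A2
  deriving DecidableEq

instance : Fintype A2 := ⟨{A2.x, A2.y}, fun c => by cases c <;> simp⟩

/-- The vertices `x_t`, `y_t` of the staircase quiver of `A₂`. The layers `1, …, s`
are represented by the elements `0, …, s - 1` of `Fin s`. -/
abbrev Vertex (s : ℕ) : Type := A2 × Fin s

/-- The layer of a vertex. -/
def layer {s : ℕ} (v : Vertex s) : Fin s := v.2

/-- Trivial paths and arrows of the staircase quiver: the trivial path at `v`, the vertical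
arrow `b : c_t ⟶ c_{t+1}` for `c ∈ {x, y}`, and the diagonal arrow `a : x_{t+1} ⟶ y_t`. -/
inductive Gen (s : ℕ) : Type
  | e (v : Vertex s) : Gen s
  | b (c : A2) (t u : Fin s) (h : (t : ℕ) + 1 = u) : Gen s
  | a (t u : Fin s) (h : (t : ℕ) + 1 = u) : Gen s

/-- The defining relations of the nilpotent quiver algebra. Paths are composed from right to
left. The first seven clauses present the path algebra of the staircase quiver, the last two are
the relations `a b = b a` and `a b = 0` (the latter starting in the lowest layer). -/
inductive Rel (k : Type u) [Field k] (s : ℕ) :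
    FreeAlgebra k (Gen s) → FreeAlgebra k (Gen s) → Prop
  | idem (v : Vertex s) :
      Rel k s (FreeAlgebra.ι k (.e v) * FreeAlgebra.ι k (.e v)) (FreeAlgebra.ι k (.e v))
  | orth (v w : Vertex s) (h : v ≠ w) :
      Rel k s (FreeAlgebra.ι k (.e v) * FreeAlgebra.ι k (.e w)) 0
  | one : Rel k s (∑ v : Vertex s, FreeAlgebra.ι k (.e v)) 1
  | b_source (c : A2) (t u : Fin s) (h : (t : ℕ) + 1 = u) :
      Rel k s (FreeAlgebra.ι k (.b c t u h) * FreeAlgebra.ι k (.e (c, t)))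
        (FreeAlgebra.ι k (.b c t u h))
  | b_target (c : A2) (t u : Fin s) (h : (t : ℕ) + 1 = u) :
      Rel k s (FreeAlgebra.ι k (.e (c, u)) * FreeAlgebra.ι k (.b c t u h))
        (FreeAlgebra.ι k (.b c t u h))
  | a_source (t u : Fin s) (h : (t : ℕ) + 1 = u) :
      Rel k s (FreeAlgebra.ι k (.a t u h) * FreeAlgebra.ι k (.e (.x, u)))
        (FreeAlgebra.ι k (.a t u h))
  | a_target (t u : Fin s) (h : (t : ℕ) + 1 = u) :
      Rel k s (FreeAlgebra.ι k (.e (.y, t)) * FreeAlgebra.ι k (.a t u h))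
        (FreeAlgebra.ι k (.a t u h))
  | mesh (r t u : Fin s) (h : (r : ℕ) + 1 = t) (h' : (t : ℕ) + 1 = u) :
      Rel k s (FreeAlgebra.ι k (.a t u h') * FreeAlgebra.ι k (.b .x t u h'))
        (FreeAlgebra.ι k (.b .y r t h) * FreeAlgebra.ι k (.a r t h))
  | mesh_zero (t u : Fin s) (h : (t : ℕ) + 1 = u) (h0 : (t : ℕ) = 0) :
      Rel k s (FreeAlgebra.ι k (.a t u h) * FreeAlgebra.ι k (.b .x t u h)) 0

/-- The nilpotent quiver algebra `N_s(A₂)`. -/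
def NAlg (k : Type u) [Field k] (s : ℕ) : Type u := RingQuot (Rel k s)

noncomputable instance (k : Type u) [Field k] (s : ℕ) : Ring (NAlg k s) :=
  inferInstanceAs (Ring (RingQuot (Rel k s)))

noncomputable instance (k : Type u) [Field k] (s : ℕ) : Algebra k (NAlg k s) :=
  inferInstanceAs (Algebra k (RingQuot (Rel k s)))

/-- The quotient map from the free algebra to `N_s(A₂)`. -/
noncomputable def mk (k : Type u) [Field k] (s : ℕ) :
    FreeAlgebra k (Gen s) →ₐ[k] NAlg k s :=
  RingQuot.mkAlgHom k (Rel k s)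

section

variable (k : Type u) [Field k] (s : ℕ)

/-- The primitive idempotent of `N_s(A₂)` at the vertex `v`. -/
noncomputable def idem (v : Vertex s) : NAlg k s :=
  mk k s (FreeAlgebra.ι k (.e v))

/-- The indecomposable projective left module `P(v) = N_s(A₂) e_v`. -/
noncomputable abbrev P (v : Vertex s) : Submodule (NAlg k s) (NAlg k s) :=
  Submodule.span (NAlg k s) {idem k s v}

/-- The simple module `S(v)`, the top of `P(v)`. -/
abbrev S (v : Vertex s) : Type u := P k s v ⧸ Module.jacobson (NAlg k s) (P k s v)

/-- `S(w)` is a composition factor of `M`: it is isomorphic to a subquotient of `M`. -/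
def IsCompositionFactor (w : Vertex s) (M : Type u) [AddCommGroup M] [Module (NAlg k s) M] :
    Prop :=
  ∃ A B : Submodule (NAlg k s) M, A ≤ B ∧ Nonempty ((B ⧸ A.submoduleOf B) ≃ₗ[NAlg k s] S k s w)

/-- The smallest submodule `N` of `P(v)` such that all composition factors of the radical of
`P(v) / N` lie in layers strictly above the layer of `v`. -/
noncomputable def standardKernel (v : Vertex s) : Submodule (NAlg k s) (P k s v) :=
  sInf {N | ∀ w : Vertex s,
    IsCompositionFactor k s w (Module.jacobson (NAlg k s) (P k s v ⧸ N)) → layer v < layer w}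

/-- The standard module `Δ(v)`: the maximal factor module of `P(v)` such that all composition
factors of its radical lie in layers strictly above the layer of `v`. -/
abbrev Δ (v : Vertex s) : Type u := P k s v ⧸ standardKernel k s v

/-- The dimension vector of `M`: `v ↦ dim_k (e_v M)`. -/
noncomputable def dimVec (M : Type u) [AddCommGroup M] [Module (NAlg k s) M] (v : Vertex s) : ℕ :=
  Module.finrank k
    (LinearMap.range (RestrictScalars.lsmul k (NAlg k s) M (idem k s v)))

/-- `M` is finite-dimensional over `k`. -/
def IsFiniteDimensional (M : Type u) [AddCommGroup M] [Module (NAlg k s) M] : Prop :=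
  Module.Finite k (RestrictScalars k (NAlg k s) M)

/-- `M` is `Δ`-filtered: there is a finite chain of submodules from `0` to `M` whose successive
quotients are standard modules. -/
def IsDeltaFiltered (M : Type u) [AddCommGroup M] [Module (NAlg k s) M] : Prop :=
  ∃ (n : ℕ) (U : ℕ → Submodule (NAlg k s) M), U 0 = ⊥ ∧ U n = ⊤ ∧
    ∀ l < n, U l ≤ U (l + 1) ∧ ∃ v : Vertex s,
      Nonempty ((U (l + 1) ⧸ (U l).submoduleOf (U (l + 1))) ≃ₗ[NAlg k s] Δ k s v)

/-- `M` is indecomposable: non-zero, and not the direct sum of two non-zero submodules. -/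
def IsIndecomposable (M : Type u) [AddCommGroup M] [Module (NAlg k s) M] : Prop :=
  Nontrivial M ∧ ∀ A B : Submodule (NAlg k s) M, IsCompl A B → A = ⊥ ∨ B = ⊥

/-- `M` is rigid: `Ext¹(M, M) = 0`. -/
def IsRigid (M : Type u) [AddCommGroup M] [Module (NAlg k s) M] : Prop :=
  Subsingleton (Abelian.Ext (ModuleCat.of (NAlg k s) M) (ModuleCat.of (NAlg k s) M) 1)

/-- `δ` is a `Δ`-dimension vector corresponding to `d`, that is, `d = ∑ δ_w [Δ(w)]`. -/
def IsDeltaDimVec (d δ : Vertex s → ℕ) : Prop :=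
  ∀ v : Vertex s, d v = ∑ w : Vertex s, δ w * dimVec k s (Δ k s w) v

/-- `M` is an indecomposable `Δ`-filtered module whose `Δ`-dimension vector is
`δ_{x_i} + δ_{y_j}`; for `j < i` this property characterises `E(i, j)`. -/
def IsE (i j : Fin s) (M : Type u) [AddCommGroup M] [Module (NAlg k s) M] : Prop :=
  IsFiniteDimensional k s M ∧ IsDeltaFiltered k s M ∧ IsIndecomposable k s M ∧
    IsDeltaDimVec k s (dimVec k s M) (Pi.single (A2.x, i) 1 + Pi.single (A2.y, j) 1)

end

/-- A dimension filtration of length `s` for `A₂`. -/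
def IsDimFiltration {s : ℕ} (d : Vertex s → ℕ) : Prop :=
  ∀ c : A2, Monotone fun t : Fin s => d (c, t)

/-- Names of the direct summands produced by the algorithm: `Δ(v)` and `E(i, j)`. -/
inductive Summand (s : ℕ) : Type
  | delta (v : Vertex s) : Summand s
  | E (i j : Fin s) : Summand s

/-- The set of `i` with `x̂_i ≠ 0`. -/
def xSupport {s : ℕ} (δ : Vertex s → ℕ) : Finset (Fin s) :=
  Finset.univ.filter fun i => δ (.x, i) ≠ 0

/-- The set of `j < i` with `ŷ_j ≠ 0`. -/
def ySupportBelow {s : ℕ} (δ : Vertex s → ℕ) (i : Fin s) : Finset (Fin s) :=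
  Finset.univ.filter fun j => j < i ∧ δ (.y, j) ≠ 0

theorem sum_x_lt {s : ℕ} (δ δ' : Vertex s → ℕ) (h : (xSupport δ).Nonempty)
    (hδ : ∀ i, δ' (.x, i) ≤
      δ (.x, i) - (Pi.single (A2.x, (xSupport δ).min' h) 1 : Vertex s → ℕ) (.x, i)) :
    ∑ i, δ' (.x, i) < ∑ i, δ (.x, i) := by
  have hm : δ (.x, (xSupport δ).min' h) ≠ 0 := by
    have := (xSupport δ).min'_mem h
    simpa [xSupport] using this
  refine Finset.sum_lt_sum (fun i _ => (hδ i).trans (Nat.sub_le _ _))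
    ⟨(xSupport δ).min' h, Finset.mem_univ _, (hδ _).trans_lt ?_⟩
  rw [Pi.single_eq_same]
  omega

/-- The greedy algorithm, started with the summands `M` collected so far and the remaining
`Δ`-dimension vector `δ`; it returns the list of all direct summands of the output. -/
def greedy {s : ℕ} (M : List (Summand s)) (δ : Vertex s → ℕ) : List (Summand s) :=
  if h : (xSupport δ).Nonempty then
    let i := (xSupport δ).min' h
    if h' : (ySupportBelow δ i).Nonempty then
      let j := (ySupportBelow δ i).max' h'
      greedy (M ++ [.E i j]) (δ - Pi.single (A2.x, i) 1 - Pi.single (A2.y, j) 1)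
    else
      greedy (M ++ [.delta (.x, i)]) (δ - Pi.single (A2.x, i) 1)
  else
    M ++ (List.finRange s).flatMap fun j => List.replicate (δ (.y, j)) (.delta (.y, j))
termination_by ∑ i, δ (.x, i)
decreasing_by
  · exact sum_x_lt _ _ h fun _ => Nat.sub_le _ _
  · exact sum_x_lt _ _ h fun _ => le_rfl

/-- The module with a given name, for a given choice of the modules `E(i, j)`. -/
noncomputable def summandModule {k : Type u} [Field k] {s : ℕ} (E : Fin s → Fin s → ModuleCat.{u} (NAlg k s)) :
    Summand s → ModuleCat.{u} (NAlg k s)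
  | .delta v => ModuleCat.of (NAlg k s) (Δ k s v)
  | .E i j => E i j

/-- The module returned by the algorithm on input `δ`, started with the zero module: the direct
sum (finite product) of the summands in the list returned by `greedy`. -/
abbrev Output {k : Type u} [Field k] {s : ℕ} (E : Fin s → Fin s → ModuleCat.{u} (NAlg k s))
    (δ : Vertex s → ℕ) : Type u :=
  ∀ n : Fin (greedy [] δ).length, summandModule E ((greedy [] δ).get n)

section Richardson

variable {k : Type u} [Field k] {s : ℕ} [NeZero s]

/-- A pair of increasing chains of subspaces of `k^{d_x}` and `k^{d_y}`. Here `⊤ : Fin s` is the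
top layer, so that `d (c, ⊤)` is the dimension of the space at the vertex `c` of `A₂`. -/
abbrev Flags (k : Type u) [Field k] {s : ℕ} [NeZero s] (d : Vertex s → ℕ) : Type u :=
  ∀ c : A2, Fin s → Submodule k (Fin (d (c, ⊤)) → k)

/-- `F` is a flag of dimension filtration `d`. -/
def IsFlag (d : Vertex s → ℕ) (F : Flags k d) : Prop :=
  ∀ c : A2, Monotone (F c) ∧ ∀ t : Fin s, Module.finrank k (F c t) = d (c, t)

/-- The space of all `k^{d_x} → k^{d_y}` that map each `F_x^{(t)}` into `F_y^{(t-1)}`, where the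
flag is extended by `0` below its lowest layer. -/
def repFlag (d : Vertex s → ℕ) (F : Flags k d) :
    Set (Matrix (Fin (d (.y, ⊤))) (Fin (d (.x, ⊤))) k) :=
  {M | (∀ t : Fin s, (t : ℕ) = 0 → ∀ v ∈ F .x t, M.mulVec v = 0) ∧
    ∀ t u : Fin s, (u : ℕ) + 1 = t → ∀ v ∈ F .x t, M.mulVec v ∈ F .y u}

/-- The group at the vertex `c` of `A₂` of all invertible matrices that stabilise the flag. -/
def flagStabilizer (d : Vertex s → ℕ) (F : Flags k d) (c : A2) :
    Set (Matrix.GeneralLinearGroup (Fin (d (c, ⊤))) k) :=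
  {g | ∀ t : Fin s, ∀ v ∈ F c t, g.val.mulVec v ∈ F c t}

/-- The orbit of `M` under the parabolic group stabilising the flag. -/
def parabolicOrbit (d : Vertex s → ℕ) (F : Flags k d)
    (M : Matrix (Fin (d (.y, ⊤))) (Fin (d (.x, ⊤))) k) :
    Set (Matrix (Fin (d (.y, ⊤))) (Fin (d (.x, ⊤))) k) :=
  {N | ∃ g ∈ flagStabilizer d F .x, ∃ h ∈ flagStabilizer d F .y,
    N = h.val * M * (g⁻¹).val}

/-- There is a quiver-graded Richardson orbit: some orbit of the parabolic group in the space
`repFlag d F` is Zariski dense in it, i.e. every polynomial in the matrix entries that vanishes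
on the orbit vanishes on the whole space. -/
def HasRichardsonOrbit (d : Vertex s → ℕ) (F : Flags k d) : Prop :=
  ∃ M ∈ repFlag d F, ∀ f : MvPolynomial (Fin (d (.y, ⊤)) × Fin (d (.x, ⊤))) k,
    (∀ N ∈ parabolicOrbit d F M, MvPolynomial.eval (fun p => N p.1 p.2) f = 0) →
      ∀ N ∈ repFlag d F, MvPolynomial.eval (fun p => N p.1 p.2) f = 0

end Richardson

end NilpA2

/-! Layers are counted from 0. Every module that matters is a staircase: for starting layers `p`,
`q` it has one basis vector at each `x_n` with `n ≥ p` and at each `y_n` with `n ≥ q`; `b` moves up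
one layer and `a` sends the vector at `x_n` to the one at `y_{n-1}`. It is presented by generators
`ξ` at `x_p` and `η` at `y_q` with the single relation `a ξ = b ^ (p - 1 - q) η`. The modules
`Δ(x_i)`, `Δ(y_j)`, `E(i, j)` are the staircases without `y`-part, without `x`-part, and with both
parts (`exists_staircase_standard`, `IsE.exists_staircase`). An explicit model gives existence of
`E(i, j)`, the presentation gives uniqueness (`Staircase.nonempty_equiv`). As `[Δ(v)]` is the
indicator function of the part of the column of `v` from `v` upwards, the coefficients of `d` are
its successive differences.

Rigidity: a map out of the staircase `(p, q)` lifts along a surjection with kernel `N` once every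
element of `N` at `y_{p-1}` has the form `a z₁ + b ^ (p - 1 - q) z₂`. If `N` is the staircase `(p',
q')`, its space at `y_{p-1}` is zero unless `q' < p`; otherwise it is a line, reached by `b` when
`q' ≤ q` and by `a` when `p' ≤ p`. This is the condition `Orthogonal`. Taking `i` minimal and `j`
maximal is what makes it hold for all pairs of summands (`GreedyRun.orthogonal`, `isRigid_pi`).

Richardson orbit: take bases adapted to the two flags, indexed by the `x`-parts and the `y`-parts of
the summands, and let `M` send each `x`-vector to the `y`-vector of the same summand, or to zero.
The same orthogonality solves `h M - M g = ψ` coefficient by coefficient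
(`hasRichardsonOrbit_of_bases`), so the orbit of `M` is infinitesimally everything. Density then
follows over any infinite field, in every characteristic, from a polynomial curve of group elements
that moves `M` along the line towards a given point (`eval_eq_zero_of_infinitesimally_transitive`).
-/

namespace NilpA2

set_option linter.unusedSectionVars false

/-! ### Arithmetic of idempotents and arrows, with indices in `ℕ` and arrows extended by zero. -/

section Generators

variable (k : Type u) [Field k] (s : ℕ)

/-- The idempotent at the vertex `c_n`, extended by zero to all natural numbers `n`. -/
noncomputable def vtx (c : A2) (n : ℕ) : NAlg k s :=
  if h : n < s then idem k s (c, ⟨n, h⟩) else 0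

/-- The arrow `b : c_n ⟶ c_{n+1}`, extended by zero. -/
noncomputable def bArrow (c : A2) (n : ℕ) : NAlg k s :=
  if h : n + 1 < s then
    mk k s (FreeAlgebra.ι k (.b c ⟨n, Nat.lt_of_succ_lt h⟩ ⟨n + 1, h⟩ rfl)) else 0

/-- The arrow `a : x_{n+1} ⟶ y_n`, extended by zero. -/
noncomputable def aArrow (n : ℕ) : NAlg k s :=
  if h : n + 1 < s then
    mk k s (FreeAlgebra.ι k (.a ⟨n, Nat.lt_of_succ_lt h⟩ ⟨n + 1, h⟩ rfl)) else 0

/-- The sum of all arrows `b`. -/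
noncomputable def bSum : NAlg k s := ∑ v : Vertex s, bArrow k s v.1 v.2

/-- The sum of all arrows `a`. -/
noncomputable def aSum : NAlg k s := ∑ t : Fin s, aArrow k s t

variable {k s}

theorem mk_rel {p q : FreeAlgebra k (Gen s)} (h : Rel k s p q) : mk k s p = mk k s q :=
  RingQuot.mkAlgHom_rel k h

theorem mk_surjective : Function.Surjective (mk k s) :=
  RingQuot.mkAlgHom_surjective k (Rel k s)

theorem idem_eq_vtx (v : Vertex s) : idem k s v = vtx k s v.1 v.2 := by
  simp [vtx]

theorem vtx_of_le {c : A2} {n : ℕ} (h : s ≤ n) : vtx k s c n = 0 := by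
  simp [vtx, h]

theorem sum_vtx : ∑ v : Vertex s, vtx k s v.1 v.2 = 1 := by
  simp_rw [← idem_eq_vtx, idem, ← map_sum, mk_rel Rel.one, map_one]

theorem vtx_mul_self (c : A2) (n : ℕ) : vtx k s c n * vtx k s c n = vtx k s c n := by
  unfold vtx
  split_ifs with h
  · rw [idem, ← map_mul, mk_rel (Rel.idem _)]
  · simp

theorem vtx_mul_of_ne {c c' : A2} {n n' : ℕ} (h : (c, n) ≠ (c', n')) :
    vtx k s c n * vtx k s c' n' = 0 := by
  unfold vtx
  split_ifs with h1 h2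
  · rw [idem, idem, ← map_mul, mk_rel (Rel.orth _ _ _), map_zero]
    intro e
    simp only [Prod.mk.injEq, Fin.mk.injEq] at e
    exact h (by simp [e.1, e.2])
  all_goals simp

theorem bArrow_mul_vtx (c : A2) (n : ℕ) : bArrow k s c n * vtx k s c n = bArrow k s c n := by
  unfold bArrow
  split_ifs with h
  · rw [vtx, dif_pos (Nat.lt_of_succ_lt h), idem, ← map_mul, mk_rel (Rel.b_source _ _ _ _)]
  · simp

theorem vtx_mul_bArrow (c : A2) (n : ℕ) :
    vtx k s c (n + 1) * bArrow k s c n = bArrow k s c n := by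
  unfold bArrow
  split_ifs with h
  · rw [vtx, dif_pos h, idem, ← map_mul, mk_rel (Rel.b_target _ _ _ _)]
  · simp

theorem aArrow_mul_vtx (n : ℕ) : aArrow k s n * vtx k s .x (n + 1) = aArrow k s n := by
  unfold aArrow
  split_ifs with h
  · rw [vtx, dif_pos h, idem, ← map_mul, mk_rel (Rel.a_source _ _ _)]
  · simp

theorem vtx_mul_aArrow (n : ℕ) : vtx k s .y n * aArrow k s n = aArrow k s n := by
  unfold aArrow
  split_ifs with h
  · rw [vtx, dif_pos (Nat.lt_of_succ_lt h), idem, ← map_mul, mk_rel (Rel.a_target _ _ _)]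
  · simp

theorem aArrow_mul_bArrow (n : ℕ) (h : n + 2 < s) :
    aArrow k s (n + 1) * bArrow k s .x (n + 1) = bArrow k s .y n * aArrow k s n := by
  rw [aArrow, dif_pos (show n + 1 + 1 < s from h), bArrow,
    dif_pos (show n + 1 + 1 < s from h), ← map_mul, mk_rel (Rel.mesh ⟨n, by omega⟩ _ _ rfl _),
    map_mul, aArrow, dif_pos (by omega), bArrow, dif_pos (by omega)]

theorem aArrow_mul_bArrow_zero : aArrow k s 0 * bArrow k s .x 0 = 0 := by
  unfold aArrow bArrow
  split_ifs with h
  · rw [← map_mul, mk_rel (Rel.mesh_zero _ _ _ rfl), map_zero]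
  · simp

theorem bSum_mul_vtx (c : A2) (n : ℕ) : bSum k s * vtx k s c n = bArrow k s c n := by
  rw [bSum, Finset.sum_mul]
  by_cases h : n < s
  · rw [Finset.sum_eq_single ((c, ⟨n, h⟩) : Vertex s)]
    · exact bArrow_mul_vtx c n
    · rintro ⟨c', t⟩ - hne
      rw [← bArrow_mul_vtx, mul_assoc, vtx_mul_of_ne, mul_zero]
      intro e
      simp only [Prod.mk.injEq] at e
      exact hne (by ext <;> simp [e.1, e.2])
    · simp
  · rw [vtx_of_le (by omega), bArrow, dif_neg (by omega)]
    simp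

theorem vtx_succ_mul_bSum (c : A2) (n : ℕ) : vtx k s c (n + 1) * bSum k s = bArrow k s c n := by
  rw [bSum, Finset.mul_sum]
  by_cases h : n < s
  · rw [Finset.sum_eq_single ((c, ⟨n, h⟩) : Vertex s)]
    · exact vtx_mul_bArrow c n
    · rintro ⟨c', t⟩ - hne
      rw [← vtx_mul_bArrow, ← mul_assoc, vtx_mul_of_ne, zero_mul]
      intro e
      simp only [Prod.mk.injEq] at e
      exact hne (by ext <;> simp [e.1]; omega)
    · simp
  · rw [vtx_of_le (by omega), bArrow, dif_neg (by omega)]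
    simp

theorem aSum_mul_vtx_y (n : ℕ) : aSum k s * vtx k s .y n = 0 := by
  rw [aSum, Finset.sum_mul]
  refine Finset.sum_eq_zero fun v _ => ?_
  rw [← aArrow_mul_vtx, mul_assoc, vtx_mul_of_ne (by simp), mul_zero]

theorem aSum_mul_vtx_zero (c : A2) : aSum k s * vtx k s c 0 = 0 := by
  rw [aSum, Finset.sum_mul]
  refine Finset.sum_eq_zero fun v _ => ?_
  rw [← aArrow_mul_vtx, mul_assoc, vtx_mul_of_ne (by simp), mul_zero]

theorem aSum_mul_vtx_succ (n : ℕ) : aSum k s * vtx k s .x (n + 1) = aArrow k s n := by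
  rw [aSum, Finset.sum_mul]
  by_cases h : n < s
  · rw [Finset.sum_eq_single (⟨n, h⟩ : Fin s)]
    · exact aArrow_mul_vtx n
    · rintro t - hne
      rw [← aArrow_mul_vtx, mul_assoc, vtx_mul_of_ne, mul_zero]
      intro e
      simp only [Prod.mk.injEq] at e
      exact hne (by ext; simp; omega)
    · simp
  · rw [vtx_of_le (by omega), aArrow, dif_neg (by omega)]
    simp

theorem vtx_y_mul_aSum (n : ℕ) : vtx k s .y n * aSum k s = aArrow k s n := by
  rw [aSum, Finset.mul_sum]
  by_cases h : n < s
  · rw [Finset.sum_eq_single (⟨n, h⟩ : Fin s)]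
    · exact vtx_mul_aArrow n
    · rintro t - hne
      rw [← vtx_mul_aArrow, ← mul_assoc, vtx_mul_of_ne, zero_mul]
      intro e
      simp only [Prod.mk.injEq] at e
      exact hne (by ext; simp [e.2])
    · simp
  · rw [vtx_of_le (by omega), aArrow, dif_neg (by omega)]
    simp

theorem vtx_comm_bSum (c : A2) (n : ℕ) :
    vtx k s c (n + 1) * bSum k s = bSum k s * vtx k s c n := by
  rw [vtx_succ_mul_bSum, bSum_mul_vtx]

theorem vtx_comm_aSum (n : ℕ) :
    vtx k s .y n * aSum k s = aSum k s * vtx k s .x (n + 1) := by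
  rw [vtx_y_mul_aSum, aSum_mul_vtx_succ]

/-- The bound excludes the top layer: there `b` kills `x`, whereas the path `x_n → y_{n-1} → y_n` is
subject to no relation. -/
theorem aSum_comm_bSum {n : ℕ} (h : n + 1 < s) :
    aSum k s * (bSum k s * vtx k s .x n) = bSum k s * (aSum k s * vtx k s .x n) := by
  cases n with
  | zero =>
    rw [aSum_mul_vtx_zero, mul_zero, bSum_mul_vtx, ← vtx_mul_bArrow, ← mul_assoc,
      aSum_mul_vtx_succ, aArrow_mul_bArrow_zero]
  | succ n =>
    rw [aSum_mul_vtx_succ, bSum_mul_vtx, ← vtx_mul_bArrow, ← mul_assoc, aSum_mul_vtx_succ,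
      aArrow_mul_bArrow n h, ← bSum_mul_vtx, mul_assoc, vtx_mul_aArrow]

end Generators

/-! ### Checking submodules and linear maps on generators. -/

section Modules

variable {k : Type u} [Field k] {s : ℕ}
variable {M : Type*} [AddCommGroup M] [Module k M] [Module (NAlg k s) M]
  [IsScalarTower k (NAlg k s) M]
variable {L : Type*} [AddCommGroup L] [Module k L] [Module (NAlg k s) L]
  [IsScalarTower k (NAlg k s) L]

/-- A subspace that is stable under the generators of `N_s(A₂)` is a submodule. -/
theorem smul_mem_of_generators (U : Submodule k M)
    (he : ∀ c n, ∀ m ∈ U, vtx k s c n • m ∈ U) (hb : ∀ m ∈ U, bSum k s • m ∈ U)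
    (ha : ∀ m ∈ U, aSum k s • m ∈ U) (r : NAlg k s) {m : M} (hm : m ∈ U) : r • m ∈ U := by
  obtain ⟨w, rfl⟩ := mk_surjective r
  induction w using FreeAlgebra.induction generalizing m with
  | grade0 c => rw [AlgHom.commutes, algebraMap_smul]; exact U.smul_mem c hm
  | grade1 g =>
    cases g with
    | e v =>
      change idem k s v • m ∈ U
      rw [idem_eq_vtx]
      exact he _ _ _ hm
    | b c t u h =>
      obtain ⟨u, hu⟩ := u
      obtain rfl : (t : ℕ) + 1 = u := h
      -- A single arrow is recovered from the sum of all arrows by first projecting to its source.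
      have := bSum_mul_vtx (k := k) (s := s) c t
      rw [bArrow, dif_pos hu] at this
      change mk k s (FreeAlgebra.ι k (.b c ⟨t, _⟩ ⟨t + 1, hu⟩ rfl)) • m ∈ U
      rw [← this, mul_smul]
      exact hb _ (he _ _ _ hm)
    | a t u h =>
      obtain ⟨u, hu⟩ := u
      obtain rfl : (t : ℕ) + 1 = u := h
      have := aSum_mul_vtx_succ (k := k) (s := s) t
      rw [aArrow, dif_pos hu] at this
      change mk k s (FreeAlgebra.ι k (.a ⟨t, _⟩ ⟨t + 1, hu⟩ rfl)) • m ∈ U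
      rw [← this, mul_smul]
      exact ha _ (he _ _ _ hm)
  | mul p q hp hq => rw [map_mul, mul_smul]; exact hp (hq hm)
  | add p q hp hq => rw [map_add, add_smul]; exact U.add_mem (hp hm) (hq hm)

/-- A `k`-linear map that commutes with the generators is `N_s(A₂)`-linear. -/
theorem map_smul_of_generators (f : M →ₗ[k] L)
    (he : ∀ c n m, f (vtx k s c n • m) = vtx k s c n • f m)
    (hb : ∀ m, f (bSum k s • m) = bSum k s • f m)
    (ha : ∀ m, f (aSum k s • m) = aSum k s • f m) (r : NAlg k s) (m : M) :
    f (r • m) = r • f m := by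
  -- Linearity of `f` amounts to stability of its graph in `M × L`.
  have key := smul_mem_of_generators (k := k) (s := s) (M := M × L) f.graph
    (fun c n p hp => by
      rw [LinearMap.mem_graph_iff] at hp ⊢; simp [hp, he])
    (fun p hp => by
      rw [LinearMap.mem_graph_iff] at hp ⊢; simp [hp, hb])
    (fun p hp => by
      rw [LinearMap.mem_graph_iff] at hp ⊢; simp [hp, ha]) r (m := (m, f m))
    (by simp)
  rw [LinearMap.mem_graph_iff] at key
  exact key.symm

end Modules

/-! ### Elements concentrated at one vertex. -/

section IsAt

variable {k : Type u} [Field k] {s : ℕ}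
variable {M : Type*} [AddCommGroup M] [Module (NAlg k s) M]
variable {L : Type*} [AddCommGroup L] [Module (NAlg k s) L]

variable (k s) in
/-- `m` lies in the vector space of `M` at the vertex `c_n`. -/
def IsAt (c : A2) (n : ℕ) (m : M) : Prop := vtx k s c n • m = m

theorem isAt_vtx_smul (c : A2) (n : ℕ) (m : M) : IsAt k s c n (vtx k s c n • m) := by
  rw [IsAt, ← mul_smul, vtx_mul_self]

theorem isAt_zero (c : A2) (n : ℕ) : IsAt k s c n (0 : M) := smul_zero _

theorem sum_vtx_smul (m : M) : ∑ v : Vertex s, vtx k s v.1 v.2 • m = m := by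
  rw [← Finset.sum_smul, sum_vtx, one_smul]

namespace IsAt

variable {c c' : A2} {n n' : ℕ} {m m' : M}

theorem add (h : IsAt k s c n m) (h' : IsAt k s c n m') : IsAt k s c n (m + m') := by
  rw [IsAt, smul_add, h, h']

theorem sub (h : IsAt k s c n m) (h' : IsAt k s c n m') : IsAt k s c n (m - m') := by
  rw [IsAt, smul_sub, h, h']

theorem eq_zero (h : IsAt k s c n m) (hn : s ≤ n) : m = 0 := by
  rw [← h, vtx_of_le hn, zero_smul]

theorem smul_of_ne (h : IsAt k s c n m) (hne : (c', n') ≠ (c, n)) : vtx k s c' n' • m = 0 := by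
  rw [← h, ← mul_smul, vtx_mul_of_ne hne, zero_smul]

theorem map (h : IsAt k s c n m) (f : M →ₗ[NAlg k s] L) : IsAt k s c n (f m) := by
  rw [IsAt, ← map_smul, h]

theorem bSum_smul (h : IsAt k s c n m) : IsAt k s c (n + 1) (bSum k s • m) := by
  rw [IsAt, ← mul_smul, vtx_comm_bSum, mul_smul, h]

theorem bSum_pow_smul (h : IsAt k s c n m) (r : ℕ) : IsAt k s c (n + r) (bSum k s ^ r • m) := by
  induction r with
  | zero => simpa using h
  | succ r ih => rw [pow_succ', mul_smul]; exact ih.bSum_smul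

theorem aSum_smul (h : IsAt k s .x (n + 1) m) : IsAt k s .y n (aSum k s • m) := by
  rw [IsAt, ← mul_smul, vtx_comm_aSum, mul_smul, h]

theorem aSum_smul_y (h : IsAt k s .y n m) : aSum k s • m = 0 := by
  rw [← h, ← mul_smul, aSum_mul_vtx_y, zero_smul]

theorem aSum_smul_zero (h : IsAt k s c 0 m) : aSum k s • m = 0 := by
  rw [← h, ← mul_smul, aSum_mul_vtx_zero, zero_smul]

theorem aSum_smul_pred (h : IsAt k s .x n m) : IsAt k s .y (n - 1) (aSum k s • m) := by
  cases n with
  | zero => rw [h.aSum_smul_zero]; exact isAt_zero _ _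
  | succ n => exact h.aSum_smul

theorem aSum_bSum (h : IsAt k s .x n m) (hn : n + 1 < s) :
    aSum k s • bSum k s • m = bSum k s • aSum k s • m := by
  rw [← h, ← mul_smul, ← mul_smul, ← mul_smul, ← mul_smul, mul_assoc, aSum_comm_bSum hn,
    mul_assoc]

theorem aSum_bSum_pow (h : IsAt k s .x n m) {r : ℕ} (hn : n + r < s) :
    aSum k s • bSum k s ^ r • m = bSum k s ^ r • aSum k s • m := by
  induction r with
  | zero => simp
  | succ r ih =>
    rw [pow_succ', mul_smul, (h.bSum_pow_smul r).aSum_bSum (by omega), ih (by omega),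
      ← mul_smul]

end IsAt

/-- Every element at a vertex lifts along a surjective map to an element at that vertex. -/
theorem IsAt.exists_lift {c : A2} {n : ℕ} {m : M} (h : IsAt k s c n m) {f : L →ₗ[NAlg k s] M}
    (hf : Function.Surjective f) : ∃ l : L, IsAt k s c n l ∧ f l = m := by
  obtain ⟨l, rfl⟩ := hf m
  exact ⟨_, isAt_vtx_smul c n l, by rw [map_smul, h]⟩

end IsAt

/-! ### Staircase modules and their presentation. -/

section Staircase

variable {k : Type u} [Field k] {s : ℕ}
variable {M : Type*} [AddCommGroup M] [Module k M] [Module (NAlg k s) M]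
  [IsScalarTower k (NAlg k s) M]
variable {L : Type*} [AddCommGroup L] [Module k L] [Module (NAlg k s) L]
  [IsScalarTower k (NAlg k s) L]

theorem IsAt.smul {c : A2} {n : ℕ} {m : M} (h : IsAt k s c n m) (r : k) :
    IsAt k s c n (r • m) := by
  rw [IsAt, smul_algebra_smul_comm, h]

/-- The starting layer of the `x`-part or the `y`-part of a staircase module. -/
def start (p q : ℕ) : A2 → ℕ
  | .x => p
  | .y => q

variable (k s) in
/-- The elements `β c n`, for `n` not below the starting layer of `c`, form a `k`-basis of `M`
which is permuted by the arrows of the quiver as far as possible. -/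
structure Staircase (p q : ℕ) (β : A2 → ℕ → M) : Prop where
  isAt (c n) : IsAt k s c n (β c n)
  low (c n) : n < start p q c → β c n = 0
  b (c n) : start p q c ≤ n → bSum k s • β c n = β c (n + 1)
  a (n) : p ≤ n → n < s → aSum k s • β .x n = β .y (n - 1)
  ne_zero (c n) : n < s → start p q c ≤ n → β c n ≠ 0
  line (c n m) : IsAt k s c n m → ∃ r : k, m = r • β c n

/-- The vertices at which a staircase module does not vanish. -/
abbrev Support (s p q : ℕ) : Type := {v : Vertex s // start p q v.1 ≤ v.2}

namespace Staircase

variable {p q : ℕ} {β : A2 → ℕ → M}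

theorem zero_of_le (h : Staircase k s p q β) (c : A2) {n : ℕ} (hn : s ≤ n) : β c n = 0 :=
  (h.isAt c n).eq_zero hn

theorem bSum_pow (h : Staircase k s p q β) (c : A2) (n r : ℕ) (hn : start p q c ≤ n) :
    bSum k s ^ r • β c n = β c (n + r) := by
  induction r with
  | zero => simp
  | succ r ih => rw [pow_succ', mul_smul, ih, h.b c _ (by omega)]; rfl

/-- The vectors sit at distinct vertices, so the idempotent at one vertex isolates one coefficient.
-/
theorem linearIndependent (h : Staircase k s p q β) :
    LinearIndependent k fun v : Support s p q => β v.1.1 v.1.2 := by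
  rw [Fintype.linearIndependent_iff]
  intro g hg v
  have := congrArg (fun m => vtx k s v.1.1 v.1.2 • m) hg
  simp only [Finset.smul_sum, smul_zero] at this
  rw [Finset.sum_eq_single v] at this
  · rw [smul_algebra_smul_comm, h.isAt] at this
    exact (smul_eq_zero.1 this).resolve_right (h.ne_zero _ _ v.1.2.2 v.2)
  · intro w _ hw
    rw [smul_algebra_smul_comm, (h.isAt _ _).smul_of_ne, smul_zero]
    intro e
    simp only [Prod.mk.injEq] at e
    exact hw (Subtype.ext (Prod.ext e.1.symm (Fin.ext e.2.symm)))
  · simp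

theorem span_eq_top (h : Staircase k s p q β) :
    Submodule.span k (Set.range fun v : Support s p q => β v.1.1 v.1.2) = ⊤ := by
  refine eq_top_iff.2 fun m _ => ?_
  rw [← sum_vtx_smul (k := k) (s := s) m]
  refine Submodule.sum_mem _ fun v _ => ?_
  obtain ⟨r, hr⟩ := h.line _ _ _ (isAt_vtx_smul v.1 v.2 m)
  rw [hr]
  by_cases hv : start p q v.1 ≤ v.2
  · exact Submodule.smul_mem _ _ (Submodule.subset_span ⟨⟨v, hv⟩, rfl⟩)
  · rw [h.low _ _ (by omega), smul_zero]
    exact Submodule.zero_mem _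

/-- The `k`-basis of a staircase module. -/
noncomputable def basis (h : Staircase k s p q β) : Module.Basis (Support s p q) k M :=
  Module.Basis.mk h.linearIndependent h.span_eq_top.ge

theorem basis_apply (h : Staircase k s p q β) (v : Support s p q) :
    h.basis v = β v.1.1 v.1.2 := by
  rw [basis, Module.Basis.mk_apply]

theorem hom_ext (h : Staircase k s p q β) {f g : M →ₗ[NAlg k s] L}
    (hx : f (β .x p) = g (β .x p)) (hy : f (β .y q) = g (β .y q)) : f = g := by
  have : f.restrictScalars k = g.restrictScalars k := by
    refine h.basis.ext fun v => ?_
    obtain ⟨⟨c, n⟩, hv⟩ := v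
    obtain ⟨r, hr⟩ := Nat.exists_eq_add_of_le hv
    simp only [basis_apply, LinearMap.coe_restrictScalars] at hr ⊢
    rw [hr, ← h.bSum_pow c _ r le_rfl, map_smul, map_smul]
    cases c
    · exact congrArg _ hx
    · exact congrArg _ hy
  ext m
  exact LinearMap.congr_fun this m

/-- Homomorphisms from a staircase module correspond to pairs of elements at the starting
vertices subject to one relation. -/
theorem exists_hom (h : Staircase k s p q β) (hpq : q < p ∨ s ≤ q) {ξ η : L}
    (hξ : IsAt k s .x p ξ) (hη : IsAt k s .y q η)
    (hrel : aSum k s • ξ = bSum k s ^ (p - 1 - q) • η) :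
    ∃ f : M →ₗ[NAlg k s] L, f (β .x p) = ξ ∧ f (β .y q) = η := by
  let gen : A2 → L := fun c => match c with
    | .x => ξ
    | .y => η
  have hgen : ∀ c, IsAt k s c (start p q c) (gen c) := by
    intro c
    cases c
    · exact hξ
    · exact hη
  let f : M →ₗ[k] L := h.basis.constr k fun v => bSum k s ^ ((v.1.2 : ℕ) - start p q v.1.1) • gen v.1.1
  have hf : ∀ c r, f (β c (start p q c + r)) = bSum k s ^ r • gen c := by
    intro c r
    by_cases hr : start p q c + r < s
    · have := h.basis.constr_basis k
        (fun v => bSum k s ^ ((v.1.2 : ℕ) - start p q v.1.1) • gen v.1.1)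
        ⟨(c, ⟨start p q c + r, hr⟩), by simp⟩
      rw [basis_apply] at this
      refine this.trans ?_
      simp
    · rw [h.zero_of_le c (by omega), map_zero,
        ((hgen c).bSum_pow_smul r).eq_zero (by omega)]
  have hat : ∀ c n, IsAt k s c n (f (β c n)) := by
    intro c n
    by_cases hn : start p q c ≤ n
    · obtain ⟨r, rfl⟩ := Nat.exists_eq_add_of_le hn
      rw [hf]
      exact (hgen c).bSum_pow_smul r
    · rw [h.low c n (by omega), map_zero]
      exact isAt_zero _ _
  have hlin : ∀ (r : NAlg k s) m, f (r • m) = r • f m := by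
    have ext : ∀ (z : NAlg k s), (∀ v : Support s p q,
        f (z • β v.1.1 v.1.2) = z • f (β v.1.1 v.1.2)) → ∀ m, f (z • m) = z • f m := by
      intro z hz
      have : f ∘ₗ Algebra.lsmul k k M z = Algebra.lsmul k k L z ∘ₗ f :=
        h.basis.ext fun v => by simpa [basis_apply] using hz v
      exact fun m => LinearMap.congr_fun this m
    refine map_smul_of_generators f (fun c n => ext _ fun v => ?_) (ext _ fun v => ?_)
      (ext _ fun v => ?_)
    · by_cases e : (c, n) = (v.1.1, (v.1.2 : ℕ))
      · simp only [Prod.mk.injEq] at e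
        rw [e.1, e.2, h.isAt, hat]
      · rw [(h.isAt _ _).smul_of_ne e, (hat _ _).smul_of_ne e, map_zero]
    · obtain ⟨r, hr⟩ := Nat.exists_eq_add_of_le v.2
      rw [h.b _ _ v.2, hr, hf, add_assoc, hf, pow_succ', mul_smul]
    · obtain ⟨⟨c, n⟩, hv⟩ := v
      cases c with
      | y => rw [(h.isAt _ _).aSum_smul_y, (hat _ _).aSum_smul_y, map_zero]
      | x =>
        obtain ⟨r, hr⟩ := Nat.exists_eq_add_of_le hv
        change p ≤ n at hv
        change (n : ℕ) = p + r at hr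
        have hn := n.2
        change f (aSum k s • β .x n) = aSum k s • f (β .x n)
        rw [h.a _ hv hn, hr]
        refine Eq.trans ?_ (congrArg _ (hf .x r).symm)
        change _ = aSum k s • bSum k s ^ r • ξ
        rw [hξ.aSum_bSum_pow (by omega), hrel, ← mul_smul, ← pow_add]
        -- If `q < p`, the exponents add up to the distance from `y_q` to `y_{p+r-1}`. If `s ≤ q`,
        -- there is no `y`-part and both sides vanish.
        rcases hpq with hpq | hpq
        · rw [show p + r - 1 = start p q .y + (r + (p - 1 - q)) by simp only [start]; omega, hf]
        · rw [h.low _ _ (by simp only [start]; omega), hη.eq_zero hpq, smul_zero, map_zero]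
  refine ⟨{ f with map_smul' := hlin }, ?_, ?_⟩
  · exact (hf .x 0).trans (by rw [pow_zero, one_smul])
  · exact (hf .y 0).trans (by rw [pow_zero, one_smul])

/-- For `p = s` the left side vanishes, but the right side is the vector at `y_{s-1}`, which may be
non-zero. For `p > s` the power of `b` leaves the quiver and the relation is empty. This is why a
missing `x`-part is encoded by `s + 1` and not by `s`. -/
theorem rel (h : Staircase k s p q β) (hpq : q < p ∨ s ≤ q) (hp : p ≠ s) :
    aSum k s • β .x p = bSum k s ^ (p - 1 - q) • β .y q := by
  rcases lt_or_gt_of_ne hp with hp | hp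
  swap
  · rw [h.zero_of_le .x hp.le, smul_zero]
    refine Eq.trans ?_ (h.bSum_pow .y q _ le_rfl).symm
    rw [h.zero_of_le .y (by omega)]
  rw [h.a _ le_rfl hp]
  refine Eq.trans ?_ (h.bSum_pow .y q _ le_rfl).symm
  rcases hpq with hpq | hpq
  · congr 1; omega
  · rw [h.zero_of_le .y (show s ≤ q + (p - 1 - q) by omega)]
    by_cases hp : p - 1 < q
    · rw [h.low .y _ hp]
    · rw [h.zero_of_le .y (by omega)]

/-- Staircase modules with the same starting layers are isomorphic. -/
theorem nonempty_equiv (h : Staircase k s p q β) (hpq : q < p ∨ s ≤ q) (hp : p ≠ s) {γ : A2 → ℕ → L}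
    (h' : Staircase k s p q γ) : Nonempty (M ≃ₗ[NAlg k s] L) := by
  obtain ⟨f, fx, fy⟩ := h.exists_hom hpq (h'.isAt .x p) (h'.isAt .y q) (h'.rel hpq hp)
  obtain ⟨g, gx, gy⟩ := h'.exists_hom hpq (h.isAt .x p) (h.isAt .y q) (h.rel hpq hp)
  exact ⟨LinearEquiv.ofLinearMap f g (h'.hom_ext (by simp [fx, gx]) (by simp [fy, gy]))
    (h.hom_ext (by simp [fx, gx]) (by simp [fy, gy]))⟩

end Staircase

end Staircase

/-! ### An explicit staircase module for every admissible pair of starting layers. -/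

section Model

variable (k : Type u) [Field k] (s p q : ℕ)

/-- The standard basis of the staircase model, extended by zero. -/
noncomputable def stdVec (c : A2) (n : ℕ) : Support s p q →₀ k :=
  if h : n < s ∧ start p q c ≤ n then Finsupp.single ⟨(c, ⟨n, h.1⟩), h.2⟩ 1 else 0

/-- The operators by which the generators act on the staircase model. -/
noncomputable def modelOp : Gen s → Module.End k (Support s p q →₀ k)
  | .e v => Finsupp.linearCombination k fun w : Support s p q =>
      if w.1 = v then stdVec k s p q v.1 v.2 else 0
  | .b c t u _ => Finsupp.linearCombination k fun w : Support s p q =>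
      if w.1 = (c, t) then stdVec k s p q c u else 0
  | .a t u _ => Finsupp.linearCombination k fun w : Support s p q =>
      if w.1 = (.x, u) then stdVec k s p q .y t else 0

variable {k s p q}

theorem single_eq_stdVec (w : Support s p q) :
    Finsupp.single w (1 : k) = stdVec k s p q w.1.1 w.1.2 := by
  rw [stdVec, dif_pos ⟨w.1.2.2, w.2⟩]

theorem stdVec_low {c : A2} {n : ℕ} (h : n < start p q c) : stdVec k s p q c n = 0 :=
  dif_neg (by omega)

theorem modelOp_e (v : Vertex s) (c : A2) (n : Fin s) :
    modelOp k s p q (.e v) (stdVec k s p q c n) =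
      if (c, n) = v then stdVec k s p q c n else 0 := by
  by_cases h : start p q c ≤ n
  · conv_lhs => rw [stdVec, dif_pos ⟨n.2, h⟩]
    simp only [modelOp, Finsupp.linearCombination_single, one_smul, Fin.eta]
    split_ifs with e
    · subst e; rfl
    · rfl
  · rw [stdVec_low (by omega), map_zero, ite_self]

theorem modelOp_b (c' : A2) (t u : Fin s) (htu : (t : ℕ) + 1 = u) (c : A2) (n : Fin s) :
    modelOp k s p q (.b c' t u htu) (stdVec k s p q c n) =
      if (c, n) = (c', t) ∧ start p q c ≤ n then stdVec k s p q c' u else 0 := by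
  by_cases h : start p q c ≤ n
  · conv_lhs => rw [stdVec, dif_pos ⟨n.2, h⟩]
    simp [modelOp, Finsupp.linearCombination_single, h]
  · rw [stdVec_low (by omega), map_zero, if_neg (fun e => h e.2)]

theorem modelOp_a (t u : Fin s) (htu : (t : ℕ) + 1 = u) (c : A2) (n : Fin s) :
    modelOp k s p q (.a t u htu) (stdVec k s p q c n) =
      if (c, n) = (.x, u) ∧ start p q c ≤ n then stdVec k s p q .y t else 0 := by
  by_cases h : start p q c ≤ n
  · conv_lhs => rw [stdVec, dif_pos ⟨n.2, h⟩]
    simp [modelOp, Finsupp.linearCombination_single, h]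
  · rw [stdVec_low (by omega), map_zero, if_neg (fun e => h e.2)]

theorem end_ext {f g : Module.End k (Support s p q →₀ k)}
    (h : ∀ (c : A2) (n : Fin s), start p q c ≤ n → f (stdVec k s p q c n) = g (stdVec k s p q c n)) :
    f = g :=
  Finsupp.lhom_ext' fun w => LinearMap.ext_ring (by
    simpa [single_eq_stdVec] using h w.1.1 w.1.2 w.2)

/-- The condition on `p` and `q` serves the two mesh relations: unless the `y`-part is empty, it
contains the target of every diagonal arrow that starts in the `x`-part. -/
theorem modelOp_rel (hpq : q < p ∨ s ≤ q) {f g : FreeAlgebra k (Gen s)} (h : Rel k s f g) :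
    FreeAlgebra.lift k (modelOp k s p q) f = FreeAlgebra.lift k (modelOp k s p q) g := by
  cases h with
  | idem v =>
    refine end_ext fun c n _ => ?_
    simp only [map_mul, FreeAlgebra.lift_ι_apply, Module.End.mul_apply, modelOp_e]
    split_ifs with e <;> simp [modelOp_e, e]
  | orth v w hne =>
    refine end_ext fun c n _ => ?_
    simp only [map_mul, FreeAlgebra.lift_ι_apply, Module.End.mul_apply, modelOp_e, map_zero]
    split_ifs with e
    · simp only [modelOp_e, e, if_neg (Ne.symm hne)]; rfl
    · simp
  | one =>
    refine end_ext fun c n _ => ?_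
    simp [FreeAlgebra.lift_ι_apply, modelOp_e]
  | b_source c' t u htu =>
    refine end_ext fun c n _ => ?_
    simp only [map_mul, FreeAlgebra.lift_ι_apply, Module.End.mul_apply, modelOp_e, modelOp_b]
    split_ifs with e <;> simp_all [modelOp_b]
    intro hlt
    obtain ⟨⟨rfl, rfl⟩, h⟩ := ‹(_ ∧ _) ∧ _›
    omega
  | b_target c' t u htu =>
    refine end_ext fun c n _ => ?_
    simp only [map_mul, FreeAlgebra.lift_ι_apply, Module.End.mul_apply, modelOp_b]
    split_ifs with e <;> simp_all [modelOp_e]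
  | a_source t u htu =>
    refine end_ext fun c n _ => ?_
    simp only [map_mul, FreeAlgebra.lift_ι_apply, Module.End.mul_apply, modelOp_e, modelOp_a]
    split_ifs with e <;> simp_all [modelOp_a]
    intro hlt
    obtain ⟨⟨rfl, rfl⟩, h⟩ := ‹(_ ∧ _) ∧ _›
    omega
  | a_target t u htu =>
    refine end_ext fun c n _ => ?_
    simp only [map_mul, FreeAlgebra.lift_ι_apply, Module.End.mul_apply, modelOp_a]
    split_ifs with e <;> simp_all [modelOp_e]
  | mesh r t u h h' =>
    refine end_ext fun c n hn => ?_
    simp only [map_mul, FreeAlgebra.lift_ι_apply, Module.End.mul_apply, modelOp_a, modelOp_b]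
    by_cases e : (c, n) = (.x, t)
    · simp only [Prod.mk.injEq] at e
      obtain ⟨rfl, rfl⟩ := e
      simp only [start] at hn
      simp only [hn, and_self, if_true, modelOp_a, modelOp_b, start]
      rw [if_pos (by simp; omega)]
      -- If `y_r` lies outside the support, then `q < p` is impossible, so `s ≤ q` and the vector at
      -- `y_t` is zero too.
      split_ifs with e'
      · rfl
      · rw [stdVec_low]
        simp at e'
        simp only [start]
        have := n.2
        omega
    · rw [if_neg (fun e' => e e'.1), if_neg (fun e' => e e'.1)]
      simp
  -- A non-zero vector at `x_0` forces `p = 0`, hence `s ≤ q` and an empty `y`-part.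
  | mesh_zero t u h h0 =>
    refine end_ext fun c n hn => ?_
    simp only [map_mul, FreeAlgebra.lift_ι_apply, Module.End.mul_apply, modelOp_b]
    split_ifs with e
    · simp only [Prod.mk.injEq] at e
      obtain ⟨⟨rfl, rfl⟩, -⟩ := e
      simp only [start] at hn
      rw [modelOp_a, stdVec_low]
      · simp
      · simp only [start]
        have := n.2
        omega
    · simp

variable (k s p q) in
/-- The representation of `N_s(A₂)` on the staircase model. -/
noncomputable def modelRep (hpq : q < p ∨ s ≤ q) :
    NAlg k s →ₐ[k] Module.End k (Support s p q →₀ k) :=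
  RingQuot.liftAlgHom k ⟨FreeAlgebra.lift k (modelOp k s p q), fun _ _ h => modelOp_rel hpq h⟩

theorem modelRep_mk (hpq : q < p ∨ s ≤ q) (g : Gen s) :
    modelRep k s p q hpq (mk k s (FreeAlgebra.ι k g)) = modelOp k s p q g := by
  refine (RingQuot.liftAlgHom_mkAlgHom_apply ..).trans ?_
  simp

variable (k s p q) in
/-- The staircase module with starting layers `p` and `q`. -/
def Model (_ : q < p ∨ s ≤ q) : Type u := Support s p q →₀ k

noncomputable instance (h : q < p ∨ s ≤ q) : AddCommGroup (Model k s p q h) :=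
  inferInstanceAs (AddCommGroup (Support s p q →₀ k))

noncomputable instance (h : q < p ∨ s ≤ q) : Module k (Model k s p q h) :=
  inferInstanceAs (Module k (Support s p q →₀ k))

noncomputable instance (h : q < p ∨ s ≤ q) : Module (NAlg k s) (Model k s p q h) :=
  Module.compHom (Support s p q →₀ k) (modelRep k s p q h).toRingHom

theorem Model.smul_def (h : q < p ∨ s ≤ q) (r : NAlg k s) (m : Model k s p q h) :
    r • m = (modelRep k s p q h r : Module.End k (Support s p q →₀ k)) m := rfl

instance (h : q < p ∨ s ≤ q) : IsScalarTower k (NAlg k s) (Model k s p q h) :=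
  ⟨fun c r m => by rw [Model.smul_def, Model.smul_def, map_smul]; rfl⟩

/-- The basis vectors of the staircase model. -/
noncomputable def Model.vec (h : q < p ∨ s ≤ q) (c : A2) (n : ℕ) : Model k s p q h :=
  stdVec k s p q c n

theorem Model.vtx_smul (h : q < p ∨ s ≤ q) (c : A2) (n : Fin s) (m : Model k s p q h) :
    vtx k s c n • m = modelOp k s p q (.e (c, n)) m := by
  rw [vtx, dif_pos n.2, idem, Model.smul_def, modelRep_mk]

theorem Model.staircase (h : q < p ∨ s ≤ q) : Staircase k s p q (Model.vec (k := k) h) := by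
  have hat : ∀ c n, IsAt k s c n (Model.vec (k := k) h c n) := by
    intro c n
    by_cases hn : n < s
    · exact (Model.vtx_smul h c ⟨n, hn⟩ _).trans ((modelOp_e _ c ⟨n, hn⟩).trans (if_pos rfl))
    · rw [Model.vec, stdVec, dif_neg (by omega)]
      exact isAt_zero _ _
  refine ⟨hat, fun c n hn => stdVec_low hn, fun c n hn => ?_, fun n hn hs => ?_, fun c n hs hn => ?_,
    fun c n m hm => ?_⟩
  · rw [← hat c n, ← mul_smul, bSum_mul_vtx, bArrow]
    split_ifs with hs
    · rw [Model.smul_def, modelRep_mk]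
      exact (modelOp_b _ _ _ _ c ⟨n, by omega⟩).trans (if_pos ⟨rfl, hn⟩)
    · rw [zero_smul]
      exact (dif_neg (by omega) : stdVec k s p q c (n + 1) = 0).symm
  · cases n with
    | zero =>
      rw [(hat _ _).aSum_smul_zero]
      refine (dif_neg ?_ : stdVec k s p q .y 0 = 0).symm
      simp only [start]
      omega
    | succ n =>
      rw [← hat .x (n + 1), ← mul_smul, aSum_mul_vtx_succ, aArrow]
      rw [dif_pos hs, Model.smul_def, modelRep_mk]
      exact (modelOp_a _ _ _ .x ⟨n + 1, hs⟩).trans (if_pos ⟨rfl, hn⟩)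
  · change stdVec k s p q c n ≠ 0
    rw [stdVec, dif_pos ⟨hs, hn⟩]
    simp
  · by_cases hn : n < s
    · rw [← hm]
      have : ∀ m : Support s p q →₀ k, ∃ r : k,
          modelOp k s p q (.e (c, ⟨n, hn⟩)) m = r • stdVec k s p q c n := by
        intro m
        induction m using Finsupp.induction_linear with
        | zero => exact ⟨0, by simp⟩
        | add f g hf hg =>
          obtain ⟨r, hr⟩ := hf
          obtain ⟨t, ht⟩ := hg
          exact ⟨r + t, by rw [map_add, hr, ht, add_smul]⟩
        | single w r =>
          simp only [modelOp, Finsupp.linearCombination_single]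
          split_ifs with e
          · exact ⟨r, rfl⟩
          · exact ⟨0, by simp⟩
      obtain ⟨r, hr⟩ := this m
      exact ⟨r, (Model.vtx_smul h c ⟨n, hn⟩ m).trans hr⟩
    · exact ⟨0, by rw [hm.eq_zero (by omega), zero_smul]⟩

end Model

/-- The starting layer of the `x`-part of a summand; `s + 1` if there is no `x`-part. -/
def Summand.xStart {s : ℕ} : Summand s → ℕ
  | .delta (.x, i) => i
  | .delta (.y, _) => s + 1
  | .E i _ => i

/-- The starting layer of the `y`-part of a summand; `s` if there is no `y`-part. -/
def Summand.yStart {s : ℕ} : Summand s → ℕ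
  | .delta (.x, _) => s
  | .delta (.y, j) => j
  | .E _ j => j

/-! ### Cyclic modules whose generator is killed by `a`. -/

section Cyclic

variable {k : Type u} [Field k] {s : ℕ}
variable {M : Type*} [AddCommGroup M] [Module k M] [Module (NAlg k s) M]
  [IsScalarTower k (NAlg k s) M] {c : A2} {t : ℕ} {ξ : M}

/-- Below the top layer `a` commutes with `b`, so it kills every `b ^ n ξ` along with `ξ`; the
powers `b ^ n ξ` therefore span a stable subspace. -/
theorem smul_mem_span_bSum_pow (hξ : IsAt k s c t ξ) (ha : aSum k s • ξ = 0) (r : NAlg k s) :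
    r • ξ ∈ Submodule.span k (Set.range fun n : ℕ => bSum k s ^ n • ξ) := by
  have key : ∀ z : NAlg k s, (∀ n : ℕ, z • bSum k s ^ n • ξ ∈
      Submodule.span k (Set.range fun n : ℕ => bSum k s ^ n • ξ)) →
      ∀ m ∈ Submodule.span k (Set.range fun n : ℕ => bSum k s ^ n • ξ),
      z • m ∈ Submodule.span k (Set.range fun n : ℕ => bSum k s ^ n • ξ) := by
    intro z hz m hm
    induction hm using Submodule.span_induction with
    | mem m hm => obtain ⟨n, rfl⟩ := hm; exact hz n
    | zero => rw [smul_zero]; exact Submodule.zero_mem _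
    | add m m' _ _ h h' => rw [smul_add]; exact Submodule.add_mem _ h h'
    | smul r m _ h => rw [smul_algebra_smul_comm]; exact Submodule.smul_mem _ _ h
  refine smul_mem_of_generators _ (fun c' n => key _ fun n' => ?_) (key _ fun n => ?_)
    (key _ fun n => ?_) r (Submodule.subset_span ⟨0, by simp⟩)
  · by_cases e : (c', n) = (c, t + n')
    · simp only [Prod.mk.injEq] at e
      rw [e.1, e.2, hξ.bSum_pow_smul n']
      exact Submodule.subset_span ⟨n', rfl⟩
    · rw [(hξ.bSum_pow_smul n').smul_of_ne e]
      exact Submodule.zero_mem _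
  · rw [← mul_smul, ← pow_succ']
    exact Submodule.subset_span ⟨n + 1, rfl⟩
  · convert Submodule.zero_mem _
    cases c with
    | y => exact (hξ.bSum_pow_smul n).aSum_smul_y
    | x =>
      by_cases hn : t + n < s
      · rw [hξ.aSum_bSum_pow hn, ha, smul_zero]
      · rw [(hξ.bSum_pow_smul n).eq_zero (by omega), smul_zero]

/-- The elements `b ^ r ξ`, indexed by their vertices. -/
noncomputable def bOrbit (c : A2) (t : ℕ) (ξ : M) (c' : A2) (n : ℕ) : M :=
  if c' = c ∧ t ≤ n then bSum k s ^ (n - t) • ξ else 0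

theorem vtx_smul_eq_smul_bOrbit (hξ : IsAt k s c t ξ) (ha : aSum k s • ξ = 0) (r : NAlg k s)
    (c' : A2) (n : ℕ) : ∃ a : k, vtx k s c' n • r • ξ = a • bOrbit (k := k) (s := s) c t ξ c' n := by
  have := smul_mem_span_bSum_pow hξ ha r
  generalize r • ξ = m at this ⊢
  induction this using Submodule.span_induction with
  | mem m hm =>
    obtain ⟨n', rfl⟩ := hm
    by_cases e : (c', n) = (c, t + n')
    · simp only [Prod.mk.injEq] at e
      refine ⟨1, ?_⟩
      rw [e.1, e.2, bOrbit, if_pos (by simp), one_smul]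
      simpa [IsAt] using hξ.bSum_pow_smul n'
    · exact ⟨0, by simpa using (hξ.bSum_pow_smul n').smul_of_ne e⟩
  | zero => exact ⟨0, by simp⟩
  | add m m' _ _ h h' =>
    obtain ⟨a, ha⟩ := h
    obtain ⟨a', ha'⟩ := h'
    exact ⟨a + a', by rw [smul_add, ha, ha', add_smul]⟩
  | smul a m _ h =>
    obtain ⟨a', ha'⟩ := h
    exact ⟨a * a', by rw [smul_algebra_smul_comm, ha', mul_smul]⟩

theorem Summand.start_delta (v : Vertex s) :
    NilpA2.start (Summand.delta v).xStart (Summand.delta v).yStart v.1 = v.2 := by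
  obtain ⟨c, t⟩ := v
  cases c <;> rfl

theorem Summand.le_start_delta (v : Vertex s) {c : A2} (hc : c ≠ v.1) :
    s ≤ NilpA2.start (Summand.delta v).xStart (Summand.delta v).yStart c := by
  obtain ⟨c', t⟩ := v
  cases c <;> cases c' <;> simp_all [NilpA2.start, Summand.xStart, Summand.yStart]

theorem Summand.delta_valid (v : Vertex s) :
    (Summand.delta v).yStart < (Summand.delta v).xStart ∨ s ≤ (Summand.delta v).yStart := by
  obtain ⟨c, t⟩ := v
  have := t.2
  cases c <;> simp [Summand.xStart, Summand.yStart]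

/-- A cyclic module whose generator is killed by `a` and that is large enough is a staircase
module. -/
theorem staircase_of_cyclic {v : Vertex s} {ξ : M} (hξ : IsAt k s v.1 v.2 ξ)
    (ha : aSum k s • ξ = 0) (hgen : ∀ m : M, ∃ r : NAlg k s, m = r • ξ)
    (hne : ∀ n, (v.2 : ℕ) + n < s → bSum k s ^ n • ξ ≠ 0) :
    Staircase k s (Summand.delta v).xStart (Summand.delta v).yStart
      (bOrbit (k := k) (s := s) v.1 v.2 ξ) := by
  refine ⟨fun c n => ?_, fun c n hn => ?_, fun c n hn => ?_, fun n hn hs => ?_,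
    fun c n hs hn => ?_, fun c n m hm => ?_⟩
  · rw [bOrbit]
    split_ifs with h
    · have := hξ.bSum_pow_smul (n - v.2)
      rwa [← h.1, Nat.add_sub_cancel' h.2] at this
    · exact isAt_zero _ _
  · rw [bOrbit, if_neg]
    rintro ⟨rfl, h⟩
    rw [Summand.start_delta] at hn
    omega
  · by_cases hc : c = v.1
    · subst hc
      rw [Summand.start_delta] at hn
      rw [bOrbit, bOrbit, if_pos ⟨rfl, hn⟩, if_pos ⟨rfl, by omega⟩, ← mul_smul, ← pow_succ',
        Nat.sub_add_comm hn]
    · rw [bOrbit, bOrbit, if_neg (fun h => hc h.1), if_neg (fun h => hc h.1), smul_zero]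
  · obtain ⟨c, t⟩ := v
    cases c with
    | y => simp [Summand.xStart] at hn; omega
    | x =>
      simp only [Summand.xStart] at hn hξ
      rw [bOrbit, bOrbit, if_pos ⟨rfl, hn⟩, if_neg (by simp), hξ.aSum_bSum_pow (by change (t : ℕ) + (n - t) < s; omega), ha,
        smul_zero]
  · by_cases hc : c = v.1
    · subst hc
      rw [Summand.start_delta] at hn
      rw [bOrbit, if_pos ⟨rfl, hn⟩]
      exact hne _ (by omega)
    · have := Summand.le_start_delta v hc
      omega
  · obtain ⟨r, rfl⟩ := hgen m
    obtain ⟨a, h⟩ := vtx_smul_eq_smul_bOrbit hξ ha r c n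
    exact ⟨a, by rw [← h, hm]⟩

end Cyclic

/-! ### Identification of the standard modules. -/

section Standard

variable (k : Type u) [Field k] {s : ℕ}

/-- The canonical generator of `P(v)`. -/
noncomputable def top (v : Vertex s) : P k s v :=
  ⟨idem k s v, Submodule.mem_span_singleton_self _⟩

variable {k}

theorem top_isAt (v : Vertex s) : IsAt k s v.1 v.2 (top k v) := by
  refine Subtype.ext ?_
  change vtx k s v.1 v.2 * idem k s v = idem k s v
  rw [idem_eq_vtx, vtx_mul_self]

theorem exists_eq_smul_top (v : Vertex s) (m : P k s v) : ∃ r : NAlg k s, m = r • top k v := by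
  obtain ⟨r, hr⟩ := Submodule.mem_span_singleton.1 m.2
  exact ⟨r, Subtype.ext hr.symm⟩

theorem eq_top_of_top_mem {v : Vertex s} {U : Submodule (NAlg k s) (P k s v)}
    (h : top k v ∈ U) : U = ⊤ := by
  refine eq_top_iff.2 fun m _ => ?_
  obtain ⟨r, rfl⟩ := exists_eq_smul_top v m
  exact U.smul_mem r h

theorem exists_hom_projective {L : Type*} [AddCommGroup L] [Module (NAlg k s) L] {v : Vertex s}
    {ξ : L} (hξ : IsAt k s v.1 v.2 ξ) : ∃ f : P k s v →ₗ[NAlg k s] L, f (top k v) = ξ := by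
  refine ⟨LinearMap.toSpanSingleton (NAlg k s) L ξ ∘ₗ (P k s v).subtype, ?_⟩
  change idem k s v • ξ = ξ
  rw [idem_eq_vtx, hξ]

/-- A hom from `P(v)` to the staircase model of `Δ(v)`. -/
theorem exists_hom_model (v : Vertex s) :
    ∃ f : P k s v →ₗ[NAlg k s] Model k s _ _ (Summand.delta_valid v),
      f (top k v) = Model.vec (Summand.delta_valid v) v.1 v.2 :=
  exists_hom_projective ((Model.staircase _).isAt _ _)

theorem model_vec_ne_zero (v : Vertex s) :
    Model.vec (k := k) (Summand.delta_valid v) v.1 v.2 ≠ 0 :=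
  (Model.staircase _).ne_zero _ _ v.2.2 (Summand.start_delta v).le

theorem top_ne_zero (v : Vertex s) : top k v ≠ 0 := by
  obtain ⟨f, hf⟩ := exists_hom_model (k := k) v
  intro h
  rw [h, map_zero] at hf
  exact model_vec_ne_zero v hf.symm

theorem aSum_smul_model_vec (v : Vertex s) :
    aSum k s • Model.vec (k := k) (Summand.delta_valid v) v.1 v.2 = 0 := by
  obtain ⟨c, t⟩ := v
  have st := Model.staircase (k := k) (Summand.delta_valid (c, t))
  have := t.2
  cases c with
  | y => exact (st.isAt _ _).aSum_smul_y
  | x =>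
    refine (st.a _ le_rfl t.2).trans (st.low _ _ ?_)
    change (t : ℕ) - 1 < s
    omega

variable (k) in
/-- The submodule of `P(v)` generated by the diagonal arrow. -/
noncomputable def diagonal (v : Vertex s) : Submodule (NAlg k s) (P k s v) :=
  Submodule.span (NAlg k s) {aSum k s • top k v}

/-- Modulo `a` the projective is spanned by the powers of `b` on its generator. That none of them
collapses is seen by mapping to the model. -/
theorem exists_staircase_quotient (v : Vertex s) :
    Staircase k s (Summand.delta v).xStart (Summand.delta v).yStart
      (bOrbit (k := k) (s := s) v.1 v.2 ((diagonal k v).mkQ (top k v))) := by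
  refine staircase_of_cyclic ((top_isAt v).map _) ?_ ?_ ?_
  · rw [← map_smul, Submodule.mkQ_apply, Submodule.Quotient.mk_eq_zero]
    exact Submodule.mem_span_singleton_self _
  · intro m
    obtain ⟨m, rfl⟩ := Submodule.mkQ_surjective _ m
    obtain ⟨r, rfl⟩ := exists_eq_smul_top v m
    exact ⟨r, map_smul _ _ _⟩
  · intro n hn
    obtain ⟨f, hf⟩ := exists_hom_model (k := k) v
    have hker : diagonal k v ≤ LinearMap.ker f := by
      rw [diagonal, Submodule.span_singleton_le_iff_mem, LinearMap.mem_ker, map_smul, hf,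
        aSum_smul_model_vec]
    intro h
    have := congrArg ((diagonal k v).liftQ f hker) h
    rw [map_smul, Submodule.mkQ_apply, Submodule.liftQ_apply, hf, map_zero,
      (Model.staircase _).bSum_pow _ _ _ (Summand.start_delta v).le] at this
    refine (Model.staircase _).ne_zero _ _ hn ?_ this
    have := Summand.start_delta v
    omega

theorem top_notMem_jacobson (v : Vertex s) : top k v ∉ Module.jacobson (NAlg k s) (P k s v) := by
  have : Nontrivial (P k s v) := ⟨_, _, top_ne_zero v⟩
  exact fun h => (Module.jacobson_lt_top (NAlg k s) (P k s v)).ne (eq_top_of_top_mem h)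

theorem IsCompositionFactor.exists_ne_zero {w : Vertex s} {M : Type u} [AddCommGroup M]
    [Module (NAlg k s) M] (h : IsCompositionFactor k s w M) :
    ∃ m : M, vtx k s w.1 w.2 • m ≠ 0 := by
  obtain ⟨A, B, -, ⟨e⟩⟩ := h
  obtain ⟨m, hm⟩ := Submodule.mkQ_surjective _ (e.symm (Submodule.Quotient.mk (top k w)))
  refine ⟨m, fun h0 => ?_⟩
  have h1 : vtx k s w.1 w.2 • m = 0 := Subtype.ext h0
  have h2 := congrArg (A.submoduleOf B).mkQ h1
  rw [map_smul, hm, ← map_smul, ← Submodule.Quotient.mk_smul, top_isAt, map_zero,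
    LinearEquiv.map_eq_zero_iff, Submodule.Quotient.mk_eq_zero] at h2
  exact top_notMem_jacobson w h2

/-- Proper submodules of `P(y_j)` are contained in the radical. -/
theorem le_jacobson_of_ne_top {j : Fin s} {U : Submodule (NAlg k s) (P k s (.y, j))}
    (hU : U ≠ ⊤) : U ≤ Module.jacobson (NAlg k s) (P k s (.y, j)) := by
  -- The space of `P(y_j)` at `y_j` is the line through its generator, so a proper submodule is zero
  -- there.
  have hmem : ∀ W : Submodule (NAlg k s) (P k s (.y, j)), W ≠ ⊤ →
      ∀ m ∈ W, vtx k s .y j • m = 0 := by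
    intro W hW m hm
    obtain ⟨r, rfl⟩ := exists_eq_smul_top _ m
    obtain ⟨a, ha⟩ := vtx_smul_eq_smul_bOrbit (top_isAt ((.y, j) : Vertex s))
      (top_isAt (k := k) ((.y, j) : Vertex s)).aSum_smul_y r .y j
    rw [bOrbit, if_pos ⟨rfl, le_rfl⟩, Nat.sub_self, pow_zero, one_smul] at ha
    rw [ha]
    by_cases h0 : a = 0
    · rw [h0, zero_smul]
    · refine absurd (eq_top_of_top_mem ?_) hW
      have := W.smul_mem (vtx k s .y j) hm
      rw [ha] at this
      have := (W.restrictScalars k).smul_mem a⁻¹ this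
      rwa [smul_smul, inv_mul_cancel₀ h0, one_smul] at this
  refine le_sInf fun W hW => ?_
  by_contra hle
  have hsup : W ⊔ U = ⊤ := hW.2 _ (left_lt_sup.2 hle)
  have : top k ((.y, j) : Vertex s) ∈ W ⊔ U := hsup ▸ Submodule.mem_top
  obtain ⟨m, hm, m', hm', e⟩ := Submodule.mem_sup.1 this
  have h := top_isAt (k := k) ((.y, j) : Vertex s)
  rw [IsAt, ← e, smul_add, hmem W hW.1 m hm, hmem U hU m' hm', add_zero, e] at h
  exact top_ne_zero _ h.symm

/-- In layers not above that of `v`, the quotient contains only the line of its cyclic generator. A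
composition factor of the radical in such a layer would put this generator into the radical, which
is a proper submodule. -/
theorem diagonal_mem (v w : Vertex s) (h : IsCompositionFactor k s w
    (Module.jacobson (NAlg k s) (P k s v ⧸ diagonal k v))) : layer v < layer w := by
  by_contra hlt
  have hle : (w.2 : ℕ) ≤ v.2 := not_lt.1 hlt
  obtain ⟨⟨m, hm⟩, hne⟩ := h.exists_ne_zero
  have st := exists_staircase_quotient (k := k) v
  set ξ := (diagonal k v).mkQ (top k v) with hξ
  have hmem := (Module.jacobson (NAlg k s) (P k s v ⧸ diagonal k v)).smul_mem
    (vtx k s w.1 w.2) hm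
  obtain ⟨r, hr⟩ := st.line _ _ _ (isAt_vtx_smul w.1 w.2 m)
  have hne' : vtx k s w.1 w.2 • m ≠ 0 := fun e => hne (Subtype.ext e)
  rw [bOrbit] at hr
  split_ifs at hr with hc
  swap
  · exact hne' (by rw [hr, smul_zero])
  rw [show (w.2 : ℕ) - v.2 = 0 by omega, pow_zero, one_smul] at hr
  have hr0 : r ≠ 0 := by
    rintro rfl
    exact hne' (by rw [hr, zero_smul])
  rw [hr] at hmem
  have hξmem := ((Module.jacobson (NAlg k s) (P k s v ⧸ diagonal k v)).restrictScalars k).smul_mem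
    r⁻¹ hmem
  rw [smul_smul, inv_mul_cancel₀ hr0, one_smul] at hξmem
  have hξ0 : ξ ≠ 0 := by
    have := st.ne_zero v.1 v.2 v.2.2 (Summand.start_delta v).le
    rwa [bOrbit, if_pos ⟨rfl, le_rfl⟩, Nat.sub_self, pow_zero, one_smul] at this
  have : Nontrivial (P k s v ⧸ diagonal k v) := ⟨_, _, hξ0⟩
  refine (Module.jacobson_lt_top (NAlg k s) (P k s v ⧸ diagonal k v)).ne (eq_top_iff.2 ?_)
  rintro m -
  obtain ⟨m, rfl⟩ := Submodule.mkQ_surjective _ m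
  obtain ⟨r, rfl⟩ := exists_eq_smul_top v m
  rw [map_smul]
  exact Submodule.smul_mem _ _ hξmem

/-- The kernel of a non-zero map lies in the radical `J`, so `g(P) / g(J)` is isomorphic to the
simple top `P / J`. -/
theorem isCompositionFactor_of_hom {j : Fin s} {M : Type u} [AddCommGroup M]
    [Module (NAlg k s) M] (g : P k s (.y, j) →ₗ[NAlg k s] M) (hg : g ≠ 0) :
    IsCompositionFactor k s (.y, j) M := by
  set J := Module.jacobson (NAlg k s) (P k s (.y, j))
  have hJ : LinearMap.ker g ≤ J := le_jacobson_of_ne_top (by rwa [Ne, LinearMap.ker_eq_top])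
  refine ⟨J.map g, LinearMap.range g, LinearMap.map_le_range, ?_⟩
  let f := ((J.map g).submoduleOf (LinearMap.range g)).mkQ ∘ₗ g.rangeRestrict
  have hf : Function.Surjective f :=
    (Submodule.mkQ_surjective _).comp g.surjective_rangeRestrict
  have hker : LinearMap.ker f = J := by
    ext m
    rw [LinearMap.mem_ker, LinearMap.comp_apply, Submodule.mkQ_apply,
      Submodule.Quotient.mk_eq_zero]
    change g m ∈ J.map g ↔ _
    rw [← Submodule.mem_comap, Submodule.comap_map_eq, sup_eq_left.2 hJ]
  exact ⟨((Submodule.quotEquivOfEq _ _ hker.symm).trans (f.quotKerEquivOfSurjective hf)).symm⟩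

/-- The diagonal submodule is admissible by `diagonal_mem`. Conversely, if an admissible `N` missed
`a` applied to the generator, that element would be non-zero in the radical of `P(v) / N` and would
produce a composition factor at the vertex `y`, one layer below `v`. -/
theorem standardKernel_eq (v : Vertex s) : standardKernel k s v = diagonal k v := by
  refine le_antisymm (sInf_le fun w h => diagonal_mem v w h) (le_sInf fun N hN => ?_)
  rw [diagonal, Submodule.span_singleton_le_iff_mem]
  by_contra hmem
  have htop := top_isAt (k := k) v
  obtain ⟨c, ⟨t, ht⟩⟩ := v
  cases c with
  | y => exact hmem (by rw [htop.aSum_smul_y]; exact N.zero_mem)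
  | x =>
  cases t with
  | zero => exact hmem (by rw [htop.aSum_smul_zero]; exact N.zero_mem)
  | succ t =>
  set ξ := N.mkQ (top k (.x, ⟨t + 1, ht⟩)) with hξ
  have hξat : IsAt k s .x (t + 1) ξ := htop.map _
  have hη : aSum k s • ξ ≠ 0 := by
    rw [hξ, ← map_smul, Submodule.mkQ_apply, Ne, Submodule.Quotient.mk_eq_zero]
    exact hmem
  have hηat : IsAt k s .y t (aSum k s • ξ) := hξat.aSum_smul
  -- A maximal submodule `W` missing `a ξ` would together with `a ξ` generate everything. As the
  -- submodule generated by `a ξ` is zero at the vertex of `ξ`, this forces `ξ ∈ W`.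
  have hjac : aSum k s • ξ ∈ Module.jacobson (NAlg k s) (P k s (.x, ⟨t + 1, ht⟩) ⧸ N) := by
    refine (Submodule.mem_sInf).2 fun W hW => ?_
    by_contra hnot
    have hsup : W ⊔ Submodule.span (NAlg k s) {aSum k s • ξ} = ⊤ :=
      hW.2 _ (left_lt_sup.2 (by rwa [Submodule.span_singleton_le_iff_mem]))
    have : ξ ∈ W ⊔ Submodule.span (NAlg k s) {aSum k s • ξ} := hsup ▸ Submodule.mem_top
    obtain ⟨m, hm, m', hm', e⟩ := Submodule.mem_sup.1 this
    obtain ⟨r, rfl⟩ := Submodule.mem_span_singleton.1 hm'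
    obtain ⟨a, ha⟩ := vtx_smul_eq_smul_bOrbit hηat hηat.aSum_smul_y r .x (t + 1)
    rw [bOrbit, if_neg (by simp), smul_zero] at ha
    have hξW : ξ ∈ W := by
      rw [← hξat, ← e, smul_add, ha, add_zero]
      exact W.smul_mem _ hm
    refine hW.1 (eq_top_iff.2 ?_)
    rintro m -
    obtain ⟨m, rfl⟩ := Submodule.mkQ_surjective _ m
    obtain ⟨r, rfl⟩ := exists_eq_smul_top _ m
    rw [map_smul]
    exact W.smul_mem _ hξW
  have hat : IsAt k s .y t
      (⟨aSum k s • ξ, hjac⟩ : Module.jacobson (NAlg k s) (P k s (.x, ⟨t + 1, ht⟩) ⧸ N)) :=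
    Subtype.ext hηat
  obtain ⟨g, hg⟩ := exists_hom_projective (v := ((.y, ⟨t, by omega⟩) : Vertex s)) hat
  have := hN _ (isCompositionFactor_of_hom g (by
    rintro rfl
    exact hη (congrArg Subtype.val hg).symm))
  simp [layer] at this

theorem exists_staircase_standard (v : Vertex s) : ∃ β : A2 → ℕ → Δ k s v,
    Staircase k s (Summand.delta v).xStart (Summand.delta v).yStart β := by
  have : ∀ N : Submodule (NAlg k s) (P k s v), N = diagonal k v → ∃ β : A2 → ℕ → P k s v ⧸ N,
      Staircase k s (Summand.delta v).xStart (Summand.delta v).yStart β := by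
    rintro N rfl
    exact ⟨_, exists_staircase_quotient v⟩
  exact this _ (standardKernel_eq v)

end Standard

/-! ### Dimension vectors. -/

section DimVec

variable {k : Type u} [Field k] {s : ℕ}
variable {M : Type u} [AddCommGroup M] [Module k M] [Module (NAlg k s) M]
  [IsScalarTower k (NAlg k s) M]

variable (k s M) in
/-- The vector space of `M` at the vertex `c_n`. -/
def vtxSpace (c : A2) (n : ℕ) : Submodule k M where
  carrier := {m | IsAt k s c n m}
  add_mem' := IsAt.add
  zero_mem' := isAt_zero c n
  smul_mem' r _ h := h.smul r

variable (k s M) in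
/-- A module over an algebra, regarded as a vector space in two ways. -/
noncomputable def restrictScalarsEquiv : RestrictScalars k (NAlg k s) M ≃ₗ[k] M where
  __ := RestrictScalars.addEquiv k (NAlg k s) M
  map_smul' r m := by
    change RestrictScalars.addEquiv k (NAlg k s) M (r • m) = _
    rw [RestrictScalars.addEquiv_map_smul, algebraMap_smul]
    rfl

/-- Passes from the type synonym `RestrictScalars` to any compatible vector space structure on `M`
itself. -/
theorem dimVec_eq_finrank (v : Vertex s) :
    dimVec k s M v = Module.finrank k (vtxSpace k s M v.1 v.2) := by
  have : (LinearMap.range (RestrictScalars.lsmul k (NAlg k s) M (idem k s v))).map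
      (restrictScalarsEquiv k s M : RestrictScalars k (NAlg k s) M →ₗ[k] M) =
      vtxSpace k s M v.1 v.2 := by
    ext m
    rw [Submodule.mem_map]
    constructor
    · rintro ⟨_, ⟨m, rfl⟩, rfl⟩
      have := isAt_vtx_smul (k := k) (s := s) v.1 v.2 (restrictScalarsEquiv k s M m)
      rw [← idem_eq_vtx] at this
      exact this
    · intro hm
      refine ⟨(restrictScalarsEquiv k s M).symm m, ⟨(restrictScalarsEquiv k s M).symm m, ?_⟩,
        LinearEquiv.apply_symm_apply _ _⟩
      have : idem k s v • m = m := by rw [idem_eq_vtx]; exact hm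
      exact congrArg (restrictScalarsEquiv k s M).symm this
  rw [dimVec, ← LinearEquiv.finrank_map_eq (restrictScalarsEquiv k s M), this]

theorem isFiniteDimensional_iff : IsFiniteDimensional k s M ↔ Module.Finite k M :=
  Module.Finite.equiv_iff (restrictScalarsEquiv k s M)

theorem dimVec_pi {ι : Type} [Fintype ι] {X : ι → Type u} [∀ i, AddCommGroup (X i)]
    [∀ i, Module k (X i)] [∀ i, Module (NAlg k s) (X i)] [∀ i, IsScalarTower k (NAlg k s) (X i)]
    [∀ i, Module.Finite k (X i)] (v : Vertex s) :
    dimVec k s (∀ i, X i) v = ∑ i, dimVec k s (X i) v := by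
  let e : vtxSpace k s (∀ i, X i) v.1 v.2 ≃ₗ[k] ∀ i, vtxSpace k s (X i) v.1 v.2 :=
    { toFun := fun m i => ⟨m.1 i, congrFun m.2 i⟩
      invFun := fun m => ⟨fun i => m i, funext fun i => (m i).2⟩
      map_add' := fun _ _ => rfl
      map_smul' := fun _ _ => rfl
      left_inv := fun _ => rfl
      right_inv := fun _ => rfl }
  simp_rw [dimVec_eq_finrank, e.finrank_eq, Module.finrank_pi_fintype]

variable {L : Type u} [AddCommGroup L] [Module k L] [Module (NAlg k s) L]
  [IsScalarTower k (NAlg k s) L]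

theorem map_smul_field (f : M →ₗ[NAlg k s] L) (r : k) (m : M) : f (r • m) = r • f m := by
  rw [← algebraMap_smul (NAlg k s), map_smul, algebraMap_smul]

namespace Staircase

variable {p q : ℕ} {β : A2 → ℕ → M}

theorem map_equiv (h : Staircase k s p q β) (e : M ≃ₗ[NAlg k s] L) :
    Staircase k s p q fun c n => e (β c n) := by
  refine ⟨fun c n => (h.isAt c n).map e.toLinearMap, fun c n hn => by rw [h.low c n hn, map_zero],
    fun c n hn => by rw [← map_smul, h.b c n hn], fun n hn hs => by rw [← map_smul, h.a n hn hs],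
    fun c n hs hn => by simpa using h.ne_zero c n hs hn, fun c n m hm => ?_⟩
  obtain ⟨r, hr⟩ := h.line c n _ (hm.map e.symm.toLinearMap)
  refine ⟨r, ?_⟩
  have := congrArg e hr
  simp only [LinearEquiv.coe_coe, LinearEquiv.apply_symm_apply] at this
  rw [this]
  exact map_smul_field e.toLinearMap r _

theorem finite (h : Staircase k s p q β) : Module.Finite k M := Module.Finite.of_basis h.basis

theorem dimVec_eq (h : Staircase k s p q β) (v : Vertex s) :
    dimVec k s M v = if start p q v.1 ≤ v.2 then 1 else 0 := by
  rw [dimVec_eq_finrank]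
  have : vtxSpace k s M v.1 v.2 = k ∙ β v.1 v.2 := by
    ext m
    rw [Submodule.mem_span_singleton]
    constructor
    · intro hm
      obtain ⟨r, hr⟩ := h.line _ _ _ hm
      exact ⟨r, hr.symm⟩
    · rintro ⟨r, rfl⟩
      exact (h.isAt _ _).smul r
  rw [this]
  split_ifs with hv
  · exact finrank_span_singleton (h.ne_zero _ _ v.2.2 hv)
  · rw [h.low _ _ (by omega), Submodule.span_zero_singleton, finrank_bot]

theorem mem_of_generators (h : Staircase k s p q β) {U : Submodule (NAlg k s) M}
    (hx : β .x p ∈ U) (hy : β .y q ∈ U) (m : M) : m ∈ U := by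
  rw [← sum_vtx_smul (k := k) (s := s) m]
  refine U.sum_mem fun v _ => ?_
  obtain ⟨r, hr⟩ := h.line _ _ _ (isAt_vtx_smul v.1 v.2 m)
  rw [hr, ← algebraMap_smul (NAlg k s)]
  refine U.smul_mem _ ?_
  by_cases hv : start p q v.1 ≤ v.2
  · obtain ⟨n, hn⟩ := Nat.exists_eq_add_of_le hv
    rw [hn, ← h.bSum_pow _ _ _ le_rfl]
    refine U.smul_mem _ ?_
    cases v.1
    · exact hx
    · exact hy
  · rw [h.low _ _ (by omega)]
    exact U.zero_mem

theorem bSum_injective (h : Staircase k s p q β) {c : A2} {n : ℕ} {m : M} (hn : n + 1 < s)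
    (hm : IsAt k s c n m) (h0 : bSum k s • m = 0) : m = 0 := by
  obtain ⟨r, rfl⟩ := h.line _ _ _ hm
  by_cases hc : start p q c ≤ n
  · rw [smul_algebra_smul_comm, h.b _ _ hc] at h0
    rw [(smul_eq_zero.1 h0).resolve_right (h.ne_zero _ _ hn (by omega)), zero_smul]
  · rw [h.low _ _ (by omega), smul_zero]

end Staircase

theorem dimVec_standard (w v : Vertex s) :
    dimVec k s (Δ k s w) v = if w.1 = v.1 ∧ w.2 ≤ v.2 then 1 else 0 := by
  rw [(exists_staircase_standard w).choose_spec.dimVec_eq]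
  by_cases h : v.1 = w.1
  · rw [h, Summand.start_delta]
    simp
  · have := Summand.le_start_delta w h
    have := v.2.2
    rw [if_neg (by omega), if_neg (fun e => h e.1.symm)]

end DimVec

/-! ### Coefficients with respect to the standard dimension vectors. -/

section DeltaDimVec

variable {k : Type u} [Field k] {s : ℕ}

/-- The standard modules contributing at a vertex are those starting in the same column in a layer
at or below it, each with dimension one. -/
theorem isDeltaDimVec_iff {d δ : Vertex s → ℕ} : IsDeltaDimVec k s d δ ↔
    ∀ c (t : Fin s), d (c, t) = ∑ u ∈ Finset.univ.filter (· ≤ t), δ (c, u) := by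
  have : ∀ v : Vertex s, ∑ w : Vertex s, δ w * dimVec k s (Δ k s w) v =
      ∑ u ∈ Finset.univ.filter (· ≤ v.2), δ (v.1, u) := by
    intro v
    simp_rw [dimVec_standard]
    rw [Fintype.sum_prod_type, Finset.sum_eq_single v.1, Finset.sum_filter]
    · simp
    · intro c _ hc
      simp [hc]
    · simp
  simp only [IsDeltaDimVec, this]
  exact ⟨fun h c t => h (c, t), fun h v => h v.1 v.2⟩

theorem filter_le_succ {n : ℕ} (h : n + 1 < s) :
    (Finset.univ.filter fun u : Fin s => u ≤ ⟨n + 1, h⟩) =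
      insert ⟨n + 1, h⟩ (Finset.univ.filter fun u : Fin s => u ≤ ⟨n, by omega⟩) := by
  ext u
  simp [Fin.ext_iff, Fin.le_def]
  omega

/-- Partial sums are inverted by successive differences. Monotonicity of `d` makes the truncated
subtraction exact. -/
theorem existsUnique_isDeltaDimVec {d : Vertex s → ℕ} (hd : IsDimFiltration d) :
    ∃! δ : Vertex s → ℕ, IsDeltaDimVec k s d δ := by
  simp only [isDeltaDimVec_iff]
  refine ⟨fun v => d v - if h : (v.2 : ℕ) = 0 then 0 else d (v.1, ⟨v.2 - 1, by omega⟩),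
    fun c => ?_, fun δ hδ => ?_⟩
  · rintro ⟨n, hn⟩
    induction n with
    | zero =>
      rw [show (Finset.univ.filter fun u : Fin s => u ≤ ⟨0, hn⟩) = {⟨0, hn⟩} by
        ext u; simp [Fin.ext_iff, Fin.le_def]]
      simp
    | succ n ih =>
      rw [filter_le_succ hn, Finset.sum_insert (by simp), ← ih (by omega)]
      have : d (c, ⟨n, by omega⟩) ≤ d (c, ⟨n + 1, hn⟩) := hd c (by simp [Fin.le_def])
      simp
      omega
  · ext ⟨c, ⟨n, hn⟩⟩
    cases n with
    | zero =>
      have := hδ c ⟨0, hn⟩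
      rw [show (Finset.univ.filter fun u : Fin s => u ≤ ⟨0, hn⟩) = {⟨0, hn⟩} by
        ext u; simp [Fin.ext_iff, Fin.le_def]] at this
      simpa using this.symm
    | succ n =>
      have h1 := hδ c ⟨n + 1, hn⟩
      have h2 := hδ c ⟨n, by omega⟩
      rw [filter_le_succ hn, Finset.sum_insert (by simp), ← h2] at h1
      simp
      omega

end DeltaDimVec

/-! ### Filtrations by standard modules. -/

section DeltaFiltered

variable {k : Type u} [Field k] {s : ℕ}
variable {M : Type u} [AddCommGroup M] [Module (NAlg k s) M]
variable {L : Type u} [AddCommGroup L] [Module (NAlg k s) L]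

theorem nonempty_quotient_equiv {A B : Submodule (NAlg k s) M} (f : B →ₗ[NAlg k s] L)
    (hf : Function.Surjective f) (hker : ∀ m, f m = 0 ↔ (m : M) ∈ A) :
    Nonempty ((B ⧸ A.submoduleOf B) ≃ₗ[NAlg k s] L) :=
  ⟨(Submodule.quotEquivOfEq _ _ (Submodule.ext fun m => ((hker m).symm :))).trans
    (f.quotKerEquivOfSurjective hf)⟩

theorem exists_hom_of_quotient_equiv {A B : Submodule (NAlg k s) M}
    (e : (B ⧸ A.submoduleOf B) ≃ₗ[NAlg k s] L) : ∃ f : B →ₗ[NAlg k s] L,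
      Function.Surjective f ∧ ∀ m, f m = 0 ↔ (m : M) ∈ A := by
  refine ⟨e.toLinearMap ∘ₗ (A.submoduleOf B).mkQ,
    e.surjective.comp (Submodule.mkQ_surjective _), fun m => ?_⟩
  rw [LinearMap.comp_apply, LinearEquiv.coe_coe, LinearEquiv.map_eq_zero_iff, Submodule.mkQ_apply,
    Submodule.Quotient.mk_eq_zero]
  rfl

/-- The quotient `B / A` is a standard module. -/
def IsStandardStep (A B : Submodule (NAlg k s) M) : Prop :=
  A ≤ B ∧ ∃ (v : Vertex s) (f : B →ₗ[NAlg k s] Δ k s v),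
    Function.Surjective f ∧ ∀ m, f m = 0 ↔ (m : M) ∈ A

theorem isDeltaFiltered_iff : IsDeltaFiltered k s M ↔
    ∃ (n : ℕ) (U : ℕ → Submodule (NAlg k s) M), U 0 = ⊥ ∧ U n = ⊤ ∧
      ∀ l < n, IsStandardStep (U l) (U (l + 1)) := by
  refine exists_congr fun n => exists_congr fun U => and_congr_right' (and_congr_right' ?_)
  refine forall₂_congr fun l _ => and_congr_right' (exists_congr fun v => ?_)
  exact ⟨fun ⟨e⟩ => exists_hom_of_quotient_equiv e,
    fun ⟨f, hf, hker⟩ => nonempty_quotient_equiv f hf hker⟩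

theorem IsDeltaFiltered.congr (h : IsDeltaFiltered k s M) (e : M ≃ₗ[NAlg k s] L) :
    IsDeltaFiltered k s L := by
  rw [isDeltaFiltered_iff] at h ⊢
  obtain ⟨n, U, h0, hn, hstep⟩ := h
  refine ⟨n, fun l => (U l).comap e.symm.toLinearMap, ?_, ?_, fun l hl => ?_⟩
  · simp only [h0]; ext; simp
  · simp only [hn]; ext; simp
  · obtain ⟨hle, v, f, hf, hker⟩ := hstep l hl
    refine ⟨Submodule.comap_mono hle, v,
      f ∘ₗ (e.symm.toLinearMap.restrict fun m hm => hm), fun m => ?_, fun m => hker _⟩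
    obtain ⟨⟨m', hm'⟩, rfl⟩ := hf m
    refine ⟨⟨e m', ?_⟩, ?_⟩
    · simpa using hm'
    · exact congrArg f (Subtype.ext (e.symm_apply_apply m'))

theorem IsDeltaFiltered.of_subsingleton [Subsingleton M] : IsDeltaFiltered k s M :=
  ⟨0, fun _ => ⊥, rfl, Subsingleton.elim _ _, fun l hl => absurd hl (by omega)⟩

theorem IsDeltaFiltered.prod (h : IsDeltaFiltered k s M) (h' : IsDeltaFiltered k s L) :
    IsDeltaFiltered k s (M × L) := by
  rw [isDeltaFiltered_iff] at h h' ⊢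
  obtain ⟨n, U, h0, hn, hstep⟩ := h
  obtain ⟨n', U', h0', hn', hstep'⟩ := h'
  -- The chain first climbs through `M` with zero in `L`, then through `L` with all of `M`.
  refine ⟨n + n', fun l => (U (min l n)).prod (U' (l - n)), ?_, ?_, fun l hl => ?_⟩
  · simp [h0, h0']
  · simp [hn, hn']
  · by_cases hln : l < n
    · obtain ⟨hle, v, f, hf, hker⟩ := hstep l hln
      have e1 : min l n = l := by omega
      have e2 : min (l + 1) n = l + 1 := by omega
      have e3 : l - n = 0 := by omega
      have e4 : l + 1 - n = 0 := by omega
      beta_reduce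
      rw [e1, e2, e3, e4, h0']
      refine ⟨Submodule.prod_mono hle le_rfl, v,
        f ∘ₗ ((LinearMap.fst (NAlg k s) M L).restrict fun m hm => hm.1), fun m => ?_, fun m => ?_⟩
      · obtain ⟨m', rfl⟩ := hf m
        exact ⟨⟨(m', 0), m'.2, zero_mem _⟩, rfl⟩
      · exact (hker _).trans ⟨fun h => ⟨h, m.2.2⟩, fun h => h.1⟩
    · obtain ⟨hle, v, f, hf, hker⟩ := hstep' (l - n) (by omega)
      have e1 : min l n = n := by omega
      have e2 : min (l + 1) n = n := by omega
      have e4 : l + 1 - n = l - n + 1 := by omega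
      beta_reduce
      rw [e1, e2, e4, hn]
      refine ⟨Submodule.prod_mono le_rfl hle, v,
        f ∘ₗ ((LinearMap.snd (NAlg k s) M L).restrict fun m hm => hm.2), fun m => ?_, fun m => ?_⟩
      · obtain ⟨m', rfl⟩ := hf m
        exact ⟨⟨(0, m'), zero_mem _, m'.2⟩, rfl⟩
      · exact (hker _).trans ⟨fun h => ⟨m.2.1, h⟩, fun h => h.2⟩

theorem IsDeltaFiltered.pi {n : ℕ} {X : Fin n → Type u} [∀ i, AddCommGroup (X i)]
    [∀ i, Module (NAlg k s) (X i)] (h : ∀ i, IsDeltaFiltered k s (X i)) :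
    IsDeltaFiltered k s (∀ i, X i) := by
  induction n with
  | zero => exact .of_subsingleton
  | succ n ih =>
    exact ((h 0).prod (ih fun i => h i.succ)).congr (Fin.consLinearEquiv (NAlg k s) X)

theorem isDeltaFiltered_standard (v : Vertex s) : IsDeltaFiltered k s (Δ k s v) := by
  rw [isDeltaFiltered_iff]
  refine ⟨1, fun l => if l = 0 then ⊥ else ⊤, by simp, by simp, fun l hl => ?_⟩
  obtain rfl : l = 0 := by omega
  refine ⟨by simp, v, Submodule.subtype _, fun m => ⟨⟨m, by simp⟩, rfl⟩, fun m => by simp⟩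

/-- The arrows `b` act injectively on a `Δ`-filtered module. -/
theorem IsDeltaFiltered.bSum_injective (h : IsDeltaFiltered k s M) {c : A2} {n : ℕ} {m : M}
    (hn : n + 1 < s) (hm : IsAt k s c n m) (h0 : bSum k s • m = 0) : m = 0 := by
  rw [isDeltaFiltered_iff] at h
  obtain ⟨r, U, hU0, hUr, hstep⟩ := h
  -- Descent along the filtration: the image of `m` in a standard quotient is killed by `b`, hence
  -- zero, and `m` lies one step lower.
  have : ∀ l ≤ r, m ∈ U l → m = 0 := by
    intro l
    induction l with
    | zero => intro _ hml; rwa [hU0, Submodule.mem_bot] at hml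
    | succ l ih =>
      intro hl hml
      obtain ⟨-, v, f, -, hker⟩ := hstep l hl
      refine ih (by omega) ((hker ⟨m, hml⟩).1 ?_)
      have hat : IsAt k s c n (⟨m, hml⟩ : U (l + 1)) := Subtype.ext hm
      refine (exists_staircase_standard v).choose_spec.bSum_injective hn (hat.map f) ?_
      rw [← map_smul, ← map_zero f]
      exact congrArg f (Subtype.ext h0)
  exact this r le_rfl (hUr ▸ Submodule.mem_top)

end DeltaFiltered

/-! ### The modules `E(i, j)` are exactly the staircases starting at `x_i` and `y_j`. -/

section Extension

variable {k : Type u} [Field k] {s : ℕ}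
variable {M : Type u} [AddCommGroup M] [Module k M] [Module (NAlg k s) M]
  [IsScalarTower k (NAlg k s) M]

theorem IsAt.bSum_pow_ne_zero (h : IsDeltaFiltered k s M) {c : A2} {n : ℕ} {m : M}
    (hm : IsAt k s c n m) (hm0 : m ≠ 0) {r : ℕ} (hr : n + r < s) : bSum k s ^ r • m ≠ 0 := by
  induction r with
  | zero => simpa using hm0
  | succ r ih =>
    rw [pow_succ', mul_smul]
    exact fun h0 => ih (by omega) (h.bSum_injective (by omega) (hm.bSum_pow_smul r) h0)

theorem Summand.E_valid {i j : Fin s} (h : j < i) : (j : ℕ) < i ∨ s ≤ (j : ℕ) := Or.inl h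

/-- The dimension vector of a module with the `Δ`-dimension vector of `E(i, j)`. -/
theorem dimVec_of_isDeltaDimVec {i j : Fin s} {d : Vertex s → ℕ}
    (h : IsDeltaDimVec k s d (Pi.single (A2.x, i) 1 + Pi.single (A2.y, j) 1)) (v : Vertex s) :
    d v = if start i j v.1 ≤ v.2 then 1 else 0 := by
  rw [h v]
  simp only [Pi.add_apply, add_mul, Finset.sum_add_distrib, Pi.single_apply, ite_mul, one_mul,
    zero_mul, Finset.sum_ite_eq', Finset.mem_univ, if_true, dimVec_standard]
  obtain ⟨c, t⟩ := v
  cases c <;> simp [start]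

variable {i j : Fin s}

theorem exists_ne_zero_of_dimVec {v : Vertex s} (h : dimVec k s M v = 1) :
    ∃ m : M, m ≠ 0 ∧ IsAt k s v.1 v.2 m := by
  rw [dimVec_eq_finrank, finrank_eq_one_iff'] at h
  obtain ⟨m, hm, -⟩ := h
  exact ⟨m, fun h0 => hm (Subtype.ext h0), m.2⟩

theorem IsAt.exists_eq_smul {c : A2} {t : Fin s} {m m' : M} (hm' : IsAt k s c t m')
    (h : dimVec k s M (c, t) = 1) (hm : IsAt k s c t m) (hm0 : m ≠ 0) : ∃ r : k, m' = r • m := by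
  rw [dimVec_eq_finrank] at h
  obtain ⟨r, hr⟩ := (finrank_eq_one_iff_of_nonzero' (⟨m, hm⟩ : vtxSpace k s M c t)
    (fun h0 => hm0 (congrArg Subtype.val h0))).1 h ⟨m', hm'⟩
  exact ⟨r, (congrArg Subtype.val hr).symm⟩

/-- If the generators at `x_i` and `y_j` are not linked, then the module is decomposable. -/
theorem aSum_smul_ne_zero (hind : IsIndecomposable k s M) {ξ η : M} (hξ : IsAt k s .x i ξ)
    (hη : IsAt k s .y j η) (hξ0 : ξ ≠ 0) (hη0 : η ≠ 0)
    (hline : ∀ c n (m : M), IsAt k s c n m →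
      ∃ r : k, m = r • bOrbit (k := k) (s := s) .x i ξ c n + r • bOrbit (k := k) (s := s) .y j η c n) :
    aSum k s • ξ ≠ 0 := by
  intro ha
  -- If `a ξ = 0`, then `ξ` generates only `x`-vectors and `η` only `y`-vectors, which splits the
  -- module.
  have hcompl : IsCompl (Submodule.span (NAlg k s) {ξ}) (Submodule.span (NAlg k s) {η}) := by
    refine ⟨Submodule.disjoint_def.2 fun m hm hm' => ?_, codisjoint_iff.2 (eq_top_iff.2 ?_)⟩
    · obtain ⟨r, rfl⟩ := Submodule.mem_span_singleton.1 hm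
      obtain ⟨r', hr'⟩ := Submodule.mem_span_singleton.1 hm'
      rw [← sum_vtx_smul (k := k) (s := s) (r • ξ)]
      refine Finset.sum_eq_zero fun v _ => ?_
      obtain ⟨c, t⟩ := v
      cases c with
      | x =>
        obtain ⟨z, hz⟩ := vtx_smul_eq_smul_bOrbit hη hη.aSum_smul_y r' .x t
        rw [← hr', hz, bOrbit, if_neg (by simp), smul_zero]
      | y =>
        obtain ⟨z, hz⟩ := vtx_smul_eq_smul_bOrbit hξ ha r .y t
        rw [hz, bOrbit, if_neg (by simp), smul_zero]
    · rintro m -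
      rw [← sum_vtx_smul (k := k) (s := s) m]
      refine Submodule.sum_mem _ fun v _ => ?_
      obtain ⟨r, hr⟩ := hline _ _ _ (isAt_vtx_smul v.1 v.2 m)
      rw [hr, ← algebraMap_smul (NAlg k s) r, ← algebraMap_smul (NAlg k s) r]
      refine Submodule.add_mem_sup (Submodule.smul_mem _ _ ?_) (Submodule.smul_mem _ _ ?_)
      all_goals
        rw [bOrbit]
        split_ifs
        · exact Submodule.smul_mem _ _ (Submodule.mem_span_singleton_self _)
        · exact Submodule.zero_mem _
  rcases hind.2 _ _ hcompl with h | h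
  · exact hξ0 (Submodule.span_singleton_eq_bot.1 h)
  · exact hη0 (Submodule.span_singleton_eq_bot.1 h)

/-- Every module `E(i, j)` is a staircase module. -/
theorem IsE.exists_staircase (hji : j < i) (h : IsE k s i j M) :
    ∃ β : A2 → ℕ → M, Staircase k s i j β := by
  obtain ⟨hfin, hfilt, hind, hdim⟩ := h
  have hM : Module.Finite k M := isFiniteDimensional_iff.1 hfin
  have hdim' := dimVec_of_isDeltaDimVec hdim
  obtain ⟨ξ, hξ0, hξ⟩ := exists_ne_zero_of_dimVec (v := ((.x, i) : Vertex s))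
    ((hdim' _).trans (if_pos le_rfl))
  obtain ⟨η, hη0, hη⟩ := exists_ne_zero_of_dimVec (v := ((.y, j) : Vertex s))
    ((hdim' _).trans (if_pos le_rfl))
  simp only at hξ hη
  have hlow : ∀ c n (m : M), n < start i j c → IsAt k s c n m → m = 0 := by
    intro c n m hn hm
    by_cases hs : n < s
    · have h0 := hdim' (c, ⟨n, hs⟩)
      rw [if_neg (by simpa using hn), dimVec_eq_finrank, Submodule.finrank_eq_zero] at h0
      have : m ∈ vtxSpace k s M c n := hm
      simp only at h0
      rwa [h0, Submodule.mem_bot] at this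
    · exact hm.eq_zero (by omega)
  -- At each vertex the module is at most one-dimensional.
  have hone : ∀ (ζ : A2 → M), (∀ c, IsAt k s c (start i j c) (ζ c)) → (∀ c, ζ c ≠ 0) →
      ∀ c n (m : M), IsAt k s c n m → start i j c ≤ n →
        ∃ r : k, m = r • bSum k s ^ (n - start i j c) • ζ c := by
    intro ζ hζ hζ0 c n m hm hn
    by_cases hs : n < s
    · have hat := (hζ c).bSum_pow_smul (n - start i j c)
      rw [Nat.add_sub_cancel' hn] at hat
      exact IsAt.exists_eq_smul (t := ⟨n, hs⟩) hm ((hdim' _).trans (if_pos hn)) hat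
        ((hζ c).bSum_pow_ne_zero hfilt (hζ0 c) (by omega))
    · exact ⟨0, by rw [hm.eq_zero (by omega), zero_smul]⟩
  let ζ₀ : A2 → M := fun c => match c with
    | .x => ξ
    | .y => η
  have hone₀ := hone ζ₀ (fun c => by cases c <;> assumption) (fun c => by cases c <;> assumption)
  -- Only here does indecomposability enter.
  have ha : aSum k s • ξ ≠ 0 := by
    refine aSum_smul_ne_zero hind hξ hη hξ0 hη0 fun c n m hm => ?_
    by_cases hn : start i j c ≤ n
    · obtain ⟨r, hr⟩ := hone₀ c n m hm hn
      refine ⟨r, ?_⟩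
      cases c
      · rw [hr, bOrbit, bOrbit, if_pos ⟨rfl, hn⟩, if_neg (by simp), smul_zero, add_zero]; rfl
      · rw [hr, bOrbit, bOrbit, if_neg (by simp), if_pos ⟨rfl, hn⟩, smul_zero, zero_add]; rfl
    · exact ⟨0, by rw [hlow c n m (by omega) hm, zero_smul, zero_smul, add_zero]⟩
  have hji' : (j : ℕ) < i := hji
  obtain ⟨r, hr⟩ := hone₀ .y (i - 1) _ hξ.aSum_smul_pred (by simp only [start]; omega)
  have hr0 : r ≠ 0 := by
    rintro rfl
    exact ha (by rw [hr, zero_smul])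
  -- The `y`-generator is rescaled so that `a ξ` becomes exactly a power of `b` applied to it.
  let ζ : A2 → M := fun c => match c with
    | .x => ξ
    | .y => r • η
  have hζ : ∀ c, IsAt k s c (start i j c) (ζ c) := by
    intro c
    cases c
    · exact hξ
    · exact hη.smul r
  have hζ0 : ∀ c, ζ c ≠ 0 := by
    intro c
    cases c
    · exact hξ0
    · exact smul_ne_zero hr0 hη0
  have hr' : aSum k s • ξ = bSum k s ^ ((i : ℕ) - 1 - j) • r • η := by
    rw [hr, smul_algebra_smul_comm]; rfl
  refine ⟨fun c n => if start i j c ≤ n then bSum k s ^ (n - start i j c) • ζ c else 0,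
    fun c n => ?_, fun c n hn => if_neg (by omega), fun c n hn => ?_, fun n hn hs => ?_,
    fun c n hs hn => ?_, fun c n m hm => ?_⟩
  · split_ifs with hn
    · have := (hζ c).bSum_pow_smul (n - start i j c)
      rwa [Nat.add_sub_cancel' hn] at this
    · exact isAt_zero _ _
  · rw [if_pos hn, if_pos (by omega), ← mul_smul, ← pow_succ', Nat.sub_add_comm hn]
  · have h1 : start i j .x = i := rfl
    have h2 : start i j .y = j := rfl
    simp only [h1, h2]
    rw [if_pos hn, if_pos (by omega)]
    change aSum k s • bSum k s ^ (n - i) • ξ = bSum k s ^ (n - 1 - j) • r • η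
    rw [hξ.aSum_bSum_pow (by omega), hr', ← mul_smul, ← pow_add]
    congr 2
    omega
  · rw [if_pos hn]
    exact (hζ c).bSum_pow_ne_zero hfilt (hζ0 c) (by omega)
  · split_ifs with hn
    · exact hone ζ hζ hζ0 c n m hm hn
    · exact ⟨0, by rw [hlow c n m (by omega) hm, zero_smul]⟩

/-- Staircase modules starting at `x_i` and `y_j` are `Δ`-filtered. -/
theorem Staircase.isDeltaFiltered (hji : j < i) {β : A2 → ℕ → M} (h : Staircase k s i j β) :
    IsDeltaFiltered k s M := by
  have hji' : (j : ℕ) < i := hji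
  have hη : IsAt k s .y j (β .y j) := h.isAt _ _
  have hξ : IsAt k s .x i (β .x i) := h.isAt _ _
  -- The filtration is `0 ⊂ U ⊂ M` with `U ≅ Δ(y_j)` and `M / U ≅ Δ(x_i)`, both recognised as cyclic
  -- staircases.
  set U : Submodule (NAlg k s) M := Submodule.span (NAlg k s) {β .y j} with hU
  have hmem : β .y j ∈ U := Submodule.mem_span_singleton_self _
  have hat : IsAt k s .y j (⟨β .y j, hmem⟩ : U) := Subtype.ext hη
  have st1 := staircase_of_cyclic (v := ((.y, j) : Vertex s)) (ξ := (⟨β .y j, hmem⟩ : U))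
    hat hat.aSum_smul_y
    (fun m => by
      obtain ⟨r, hr⟩ := Submodule.mem_span_singleton.1 m.2
      exact ⟨r, Subtype.ext hr.symm⟩)
    (fun n hn h0 => by
      have := congrArg Subtype.val h0
      refine h.ne_zero .y (j + n) hn (by simp [start]) ?_
      rw [← h.bSum_pow .y j n le_rfl]
      exact this)
  have hz : U.mkQ (β .y j) = 0 := by
    rwa [Submodule.mkQ_apply, Submodule.Quotient.mk_eq_zero]
  have hUx : ∀ n, ∀ m ∈ U, vtx k s .x n • m = 0 := by
    intro n m hm
    obtain ⟨r, rfl⟩ := Submodule.mem_span_singleton.1 hm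
    obtain ⟨a, ha⟩ := vtx_smul_eq_smul_bOrbit hη hη.aSum_smul_y r .x n
    rw [ha, bOrbit, if_neg (by simp), smul_zero]
  have st2 := staircase_of_cyclic (v := ((.x, i) : Vertex s)) (ξ := U.mkQ (β .x i))
    (hξ.map _)
    (by
      rw [← map_smul, h.rel (Summand.E_valid hji) i.2.ne, map_smul, hz, smul_zero])
    (fun m => by
      obtain ⟨m, rfl⟩ := Submodule.mkQ_surjective _ m
      have : m ∈ Submodule.span (NAlg k s) {β .x i} ⊔ U :=
        h.mem_of_generators (Submodule.mem_sup_left (Submodule.mem_span_singleton_self _))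
          (Submodule.mem_sup_right hmem) m
      obtain ⟨m₁, hm₁, m₂, hm₂, rfl⟩ := Submodule.mem_sup.1 this
      obtain ⟨r, rfl⟩ := Submodule.mem_span_singleton.1 hm₁
      refine ⟨r, ?_⟩
      have hm0 : U.mkQ m₂ = 0 := (Submodule.Quotient.mk_eq_zero U).2 hm₂
      rw [map_add, map_smul, hm0, add_zero])
    (fun n hn h0 => by
      rw [← map_smul, Submodule.mkQ_apply, Submodule.Quotient.mk_eq_zero] at h0
      have := hUx (i + n) _ h0
      rw [hξ.bSum_pow_smul n] at this
      refine h.ne_zero .x (i + n) hn (by simp [start]) ?_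
      rw [← h.bSum_pow .x i n le_rfl]
      exact this)
  obtain ⟨_, st1'⟩ := exists_staircase_standard (k := k) ((.y, j) : Vertex s)
  obtain ⟨_, st2'⟩ := exists_staircase_standard (k := k) ((.x, i) : Vertex s)
  obtain ⟨e1⟩ := st1.nonempty_equiv (Summand.delta_valid _)
    (by simp [Summand.xStart]) st1'
  obtain ⟨e2⟩ := st2.nonempty_equiv (Summand.delta_valid _)
    (by simp only [Summand.xStart]; exact i.2.ne) st2'
  rw [isDeltaFiltered_iff]
  refine ⟨2, fun l => if l = 0 then ⊥ else if l = 1 then U else ⊤, by simp, by simp,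
    fun l hl => ?_⟩
  interval_cases l
  · refine ⟨by simp, (.y, j), e1.toLinearMap, e1.surjective, fun m => ?_⟩
    simp
  · refine ⟨by simp, (.x, i), e2.toLinearMap ∘ₗ U.mkQ ∘ₗ Submodule.subtype _, fun m => ?_,
      fun m => ?_⟩
    · obtain ⟨m', hm'⟩ := U.mkQ_surjective (e2.symm m)
      exact ⟨⟨m', by simp⟩, by simp [hm']⟩
    · simp

/-- Vertex spaces are at most lines, so each generator lies in a summand. The non-zero vector at
`y_{i-1}` is generated by both generators and ties them to the same summand. -/
theorem Staircase.isIndecomposable (hji : j < i) {β : A2 → ℕ → M} (h : Staircase k s i j β) :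
    IsIndecomposable k s M := by
  have hji' : (j : ℕ) < i := hji
  have hne : ∀ c, β c (start i j c) ≠ 0 := fun c =>
    h.ne_zero c _ (by cases c <;> simp [start]) le_rfl
  refine ⟨⟨_, _, hne .x⟩, fun A B hAB => ?_⟩
  -- A generator lies in one of the two summands.
  have hmem : ∀ A B : Submodule (NAlg k s) M, IsCompl A B → ∀ c, β c (start i j c) ∉ B →
      β c (start i j c) ∈ A := by
    intro A B hAB c hB
    have : β c (start i j c) ∈ A ⊔ B := hAB.sup_eq_top ▸ Submodule.mem_top
    obtain ⟨m, hm, m', hm', e⟩ := Submodule.mem_sup.1 this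
    have hat := h.isAt c (start i j c)
    rw [IsAt, ← e, smul_add, e] at hat
    obtain ⟨r, hr⟩ := h.line _ _ _ (isAt_vtx_smul c (start i j c) m')
    have hr0 : r = 0 := by
      by_contra hr0
      have := (B.restrictScalars k).smul_mem r⁻¹ (B.smul_mem (vtx k s c (start i j c)) hm')
      rw [hr, smul_smul, inv_mul_cancel₀ hr0, one_smul] at this
      exact hB this
    rw [hr, hr0, zero_smul, add_zero] at hat
    rw [← hat]
    exact A.smul_mem _ hm
  have hrel := h.rel (Summand.E_valid hji) i.2.ne
  have hlink : β .y (i - 1) ≠ 0 := h.ne_zero _ _ (by omega) (by simp only [start]; omega)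
  -- Both generators lie in the same summand.
  have key : ∀ A B : Submodule (NAlg k s) M, IsCompl A B → β .x i ∈ A → B = ⊥ := by
    intro A B hAB hx
    have hy : β .y j ∈ A := by
      refine hmem A B hAB .y fun hB => hlink ?_
      refine Submodule.disjoint_def.1 hAB.disjoint _ ?_ ?_
      · rw [← h.a i le_rfl i.2]
        exact A.smul_mem _ hx
      · have := B.smul_mem (bSum k s ^ ((i : ℕ) - 1 - j)) hB
        rwa [h.bSum_pow .y _ _ le_rfl, show start i j .y + ((i : ℕ) - 1 - j) = i - 1 by
          simp only [start]; omega] at this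
    have : A = ⊤ := eq_top_iff.2 fun m _ => h.mem_of_generators hx hy m
    subst this
    simpa using hAB.disjoint
  by_cases hx : β .x i ∈ B
  · exact Or.inl (key B A hAB.symm hx)
  · exact Or.inr (key A B hAB (hmem A B hAB .x hx))

theorem Staircase.isE (hji : j < i) {β : A2 → ℕ → M} (h : Staircase k s i j β) :
    IsE k s i j M := by
  refine ⟨isFiniteDimensional_iff.2 h.finite, h.isDeltaFiltered hji, h.isIndecomposable hji,
    fun v => ?_⟩
  rw [h.dimVec_eq]
  exact (dimVec_of_isDeltaDimVec (k := k) (fun _ => rfl) v).symm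

end Extension

/-! ### Existence and uniqueness of `E(i, j)`. -/

section ExistsUnique

variable {k : Type u} [Field k] {s : ℕ}

/-- The vector space structure of a module over `N_s(A₂)`. -/
noncomputable abbrev fieldModule (k : Type u) [Field k] (s : ℕ) (M : Type u) [AddCommGroup M]
    [Module (NAlg k s) M] : Module k M :=
  Module.compHom M (algebraMap k (NAlg k s))

theorem isScalarTower_fieldModule (M : Type u) [AddCommGroup M] [Module (NAlg k s) M] :
    letI := fieldModule k s M
    IsScalarTower k (NAlg k s) M :=
  letI := fieldModule k s M
  ⟨fun c r m => by rw [Algebra.smul_def, mul_smul]; rfl⟩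

theorem exists_unique_E {i j : Fin s} (hji : j < i) :
    ∃ E : ModuleCat.{u} (NAlg k s), IsE k s i j E ∧
      ∀ E' : ModuleCat.{u} (NAlg k s), IsE k s i j E' → Nonempty (E' ≃ₗ[NAlg k s] E) := by
  have hv := Summand.E_valid hji
  refine ⟨ModuleCat.of _ (Model k s i j hv), (Model.staircase hv).isE hji, fun E' hE' => ?_⟩
  let := fieldModule k s E'
  have := isScalarTower_fieldModule (k := k) (s := s) E'
  obtain ⟨β, hβ⟩ := hE'.exists_staircase hji
  exact hβ.nonempty_equiv hv i.2.ne (Model.staircase hv)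

end ExistsUnique

/-! ### Vanishing of `Ext¹` from the splitting of extensions. -/

section Ext

variable {R : Type u} [Ring R] {M N : Type u} [AddCommGroup M] [Module R M] [AddCommGroup N]
  [Module R N]

/-- If all extensions of `M` by `N` split, then a homomorphism from the kernel of a surjection
onto `M` to `N` extends. -/
theorem exists_extension_of_split
    (h : ∀ (L : Type u) [AddCommGroup L] [Module R L] (p : L →ₗ[R] M) (ι : N →ₗ[R] L),
      Function.Surjective p → Function.Injective ι → LinearMap.range ι = LinearMap.ker p →
        ∃ σ : M →ₗ[R] L, p ∘ₗ σ = LinearMap.id)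
    {Q : Type u} [AddCommGroup Q] [Module R Q] (π : Q →ₗ[R] M) (hπ : Function.Surjective π)
    (f : LinearMap.ker π →ₗ[R] N) : ∃ g : Q →ₗ[R] N, g ∘ₗ (LinearMap.ker π).subtype = f := by
  -- The quotient by `W` is the pushout of `0 → ker π → Q → M → 0` along `f`.
  let W : Submodule R (N × Q) := LinearMap.range (f.prod (-(LinearMap.ker π).subtype))
  let p : ((N × Q) ⧸ W) →ₗ[R] M := W.liftQ (π ∘ₗ LinearMap.snd R N Q) (by
    rintro _ ⟨m, rfl⟩
    simp)
  let ι : N →ₗ[R] ((N × Q) ⧸ W) := W.mkQ ∘ₗ LinearMap.inl R N Q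
  have hι : Function.Injective ι := by
    rw [injective_iff_map_eq_zero]
    intro n hn
    obtain ⟨m, hm⟩ := (Submodule.Quotient.mk_eq_zero W).1 hn
    have h1 := congrArg Prod.fst hm
    have h2 := congrArg Prod.snd hm
    simp at h1 h2
    rw [← h1, h2, map_zero]
  have hrange : LinearMap.range ι = LinearMap.ker p := by
    refine le_antisymm ?_ ?_
    · rintro _ ⟨n, rfl⟩
      simp [ι, p]
    · intro z hz
      obtain ⟨⟨n, m⟩, rfl⟩ := W.mkQ_surjective z
      have hm : π m = 0 := hz
      refine ⟨n + f ⟨m, hm⟩, ?_⟩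
      refine (Submodule.Quotient.eq W).2 ⟨⟨m, hm⟩, ?_⟩
      simp
  obtain ⟨σ, hσ⟩ := h _ p ι (fun m => by
    obtain ⟨m', rfl⟩ := hπ m
    exact ⟨W.mkQ (0, m'), rfl⟩) hι hrange
  -- Subtracting the section composed with `π` moves `Q` into the copy of `N`; on `ker π` nothing is
  -- subtracted, so `f` is recovered.
  let τ : Q →ₗ[R] ((N × Q) ⧸ W) := W.mkQ ∘ₗ LinearMap.inr R N Q - σ ∘ₗ π
  have hτ : ∀ m, τ m ∈ LinearMap.range ι := by
    intro m
    rw [hrange, LinearMap.mem_ker, LinearMap.sub_apply, map_sub]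
    have := LinearMap.congr_fun hσ (π m)
    simp only [LinearMap.comp_apply, LinearMap.id_apply] at this ⊢
    rw [this]
    exact sub_self _
  let e := LinearEquiv.ofInjective ι hι
  refine ⟨e.symm.toLinearMap ∘ₗ τ.codRestrict _ hτ, ?_⟩
  ext m
  refine hι ?_
  have h1 : ι (e.symm (τ.codRestrict _ hτ m)) = τ m :=
    congrArg Subtype.val (e.apply_symm_apply (τ.codRestrict _ hτ m))
  refine h1.trans ?_
  have hm : π m = 0 := m.2
  simp only [τ, LinearMap.sub_apply, LinearMap.comp_apply, hm, map_zero, sub_zero]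
  refine (Submodule.Quotient.eq W).2 ⟨-m, ?_⟩
  simp

/-- If all extensions of `M` by `N` split, then `Ext¹(M, N)` vanishes. -/
theorem subsingleton_ext_of_split
    (h : ∀ (L : Type u) [AddCommGroup L] [Module R L] (p : L →ₗ[R] M) (ι : N →ₗ[R] L),
      Function.Surjective p → Function.Injective ι → LinearMap.range ι = LinearMap.ker p →
        ∃ σ : M →ₗ[R] L, p ∘ₗ σ = LinearMap.id) :
    Subsingleton (Abelian.Ext (ModuleCat.of R M) (ModuleCat.of R N) 1) := by
  refine subsingleton_of_forall_eq 0 fun x => ?_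
  let Q := M →₀ R
  let π : Q →ₗ[R] M := Finsupp.linearCombination R id
  have hπ : Function.Surjective π := Finsupp.linearCombination_id_surjective R M
  have hS := LinearMap.shortExact_shortComplexKer hπ
  have : Projective π.shortComplexKer.X₂ := by
    change Projective (ModuleCat.of R Q)
    infer_instance
  -- Since `Q` is free, every class is the connecting image of some `f : ker π → N`. Extending `f`
  -- to `Q` kills that image.
  obtain ⟨y, rfl⟩ := Abelian.Ext.contravariant_sequence_exact₃ hS (ModuleCat.of R N) x
    (Abelian.Ext.eq_zero_of_projective (n := 0) _) (n₀ := 0) (add_zero 1)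
  obtain ⟨f, rfl⟩ := (Abelian.Ext.mk₀_bijective _ _).2 y
  obtain ⟨g, hg⟩ := exists_extension_of_split h π hπ f.hom
  have hfg : f = π.shortComplexKer.f ≫ ModuleCat.ofHom g := by
    ext m
    exact (LinearMap.congr_fun hg m).symm
  rw [hfg, ← Abelian.Ext.mk₀_comp_mk₀]
  exact hS.extClass_comp_assoc (Abelian.Ext.mk₀ (ModuleCat.ofHom g)) (h := add_zero 1)

end Ext

/-! ### Lifting maps out of staircases, and rigidity of orthogonal sums. -/

section Rigid

variable {k : Type u} [Field k] {s : ℕ}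

/-- The combinatorial condition for the vanishing of `Ext¹` between summands with starting
layers `p, q` and `p', q'`. -/
def Orthogonal (s p q p' q' : ℕ) : Prop :=
  p < s → q' < p → (q < s ∧ q' ≤ q) ∨ p' ≤ p

/-- The space at `y_{p-1}` is zero or a line. The first alternative of orthogonality reaches the
line from `y_q` by `b`, the second from `x_p` by `a`. -/
theorem exists_sum_of_orthogonal {M : Type u} [AddCommGroup M] [Module k M] [Module (NAlg k s) M]
    [IsScalarTower k (NAlg k s) M] {p q p' q' : ℕ} {β : A2 → ℕ → M}
    (h : Staircase k s p' q' β) (hpq : q < p ∨ s ≤ q) (hp : p < s) (hp0 : p ≠ 0)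
    (horth : Orthogonal s p q p' q') {z : M} (hz : IsAt k s .y (p - 1) z) :
    ∃ z₁ z₂ : M, IsAt k s .x p z₁ ∧ IsAt k s .y q z₂ ∧
      z = aSum k s • z₁ + bSum k s ^ (p - 1 - q) • z₂ := by
  by_cases hq' : q' < p
  · obtain ⟨r, rfl⟩ := h.line _ _ _ hz
    rcases horth hp hq' with ⟨hq, hle⟩ | hle
    · refine ⟨0, r • β .y q, isAt_zero _ _, (h.isAt _ _).smul r, ?_⟩
      rw [smul_zero, zero_add, smul_algebra_smul_comm, h.bSum_pow .y q _ hle]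
      congr 2
      omega
    · refine ⟨r • β .x p, 0, (h.isAt _ _).smul r, isAt_zero _ _, ?_⟩
      rw [smul_zero, add_zero, smul_algebra_smul_comm, h.a p hle hp]
  · obtain ⟨r, rfl⟩ := h.line _ _ _ hz
    refine ⟨0, 0, isAt_zero _ _, isAt_zero _ _, ?_⟩
    rw [h.low .y _ (by simp only [start]; omega)]
    simp

/-- Homomorphisms from a staircase module lift along surjections whose kernel satisfies the
orthogonality condition. -/
theorem exists_lift_of_staircase {M M' N L : Type u} [AddCommGroup M] [Module k M]
    [Module (NAlg k s) M] [IsScalarTower k (NAlg k s) M] [AddCommGroup L] [Module k L]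
    [Module (NAlg k s) L] [IsScalarTower k (NAlg k s) L] [AddCommGroup M'] [Module (NAlg k s) M']
    [AddCommGroup N] [Module (NAlg k s) N]
    {p q : ℕ} {β : A2 → ℕ → M} (h : Staircase k s p q β) (hpq : q < p ∨ s ≤ q) (hps : p ≠ s)
    (hN : p < s → p ≠ 0 → ∀ z : N, IsAt k s .y (p - 1) z → ∃ z₁ z₂ : N, IsAt k s .x p z₁ ∧
      IsAt k s .y q z₂ ∧ z = aSum k s • z₁ + bSum k s ^ (p - 1 - q) • z₂)
    (π : L →ₗ[NAlg k s] M') (hπ : Function.Surjective π) (ι : N →ₗ[NAlg k s] L)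
    (hι : Function.Injective ι) (hex : LinearMap.range ι = LinearMap.ker π)
    (g : M →ₗ[NAlg k s] M') : ∃ f : M →ₗ[NAlg k s] L, π ∘ₗ f = g := by
  obtain ⟨ξ, hξ, hξg⟩ := ((h.isAt .x p).map g).exists_lift hπ
  obtain ⟨η, hη, hηg⟩ := ((h.isAt .y q).map g).exists_lift hπ
  have hπι : ∀ z, π (ι z) = 0 := fun z => by
    rw [← LinearMap.mem_ker, ← hex]
    exact LinearMap.mem_range_self _ _
  have hrel := h.rel hpq hps
  -- Correct the lifts by elements of the kernel.
  have hcorr : ∃ z₁ z₂ : N, IsAt k s .x p z₁ ∧ IsAt k s .y q z₂ ∧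
      aSum k s • ξ - bSum k s ^ (p - 1 - q) • η =
        ι (aSum k s • z₁ + bSum k s ^ (p - 1 - q) • z₂) := by
    by_cases hp : p < s
    swap
    · refine ⟨0, 0, isAt_zero _ _, isAt_zero _ _, ?_⟩
      rw [hξ.eq_zero (by omega), (hη.bSum_pow_smul _).eq_zero (by omega)]
      simp
    -- Here `q < p` fails, so there is no `y`-part, and no diagonal arrow starts in the lowest
    -- layer.
    by_cases hp0 : p = 0
    · subst hp0
      refine ⟨0, 0, isAt_zero _ _, isAt_zero _ _, ?_⟩
      rw [hξ.aSum_smul_zero, hη.eq_zero (by omega)]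
      simp
    have hmem : aSum k s • ξ - bSum k s ^ (p - 1 - q) • η ∈ LinearMap.range ι := by
      rw [hex, LinearMap.mem_ker, map_sub, map_smul, map_smul, hξg, hηg, ← map_smul, ← map_smul,
        hrel, sub_self]
    obtain ⟨z, hz⟩ := hmem
    have hat : IsAt k s .y (p - 1) z := by
      refine hι ?_
      rw [map_smul, hz]
      refine hξ.aSum_smul_pred.sub ?_
      have := hη.bSum_pow_smul (p - 1 - q)
      rcases hpq with hq | hq
      · rwa [show q + (p - 1 - q) = p - 1 by omega] at this
      · rw [hη.eq_zero hq, smul_zero]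
        exact isAt_zero _ _
    obtain ⟨z₁, z₂, h₁, h₂, rfl⟩ := hN hp hp0 z hat
    exact ⟨z₁, z₂, h₁, h₂, hz.symm⟩
  obtain ⟨z₁, z₂, h₁, h₂, hz⟩ := hcorr
  -- The corrected generators `ξ - ι z₁` and `η + ι z₂` satisfy the defining relation and have the
  -- same images under `π`.
  obtain ⟨f, hfξ, hfη⟩ := h.exists_hom hpq (hξ.sub (h₁.map ι)) (hη.add (h₂.map ι)) (by
    rw [map_add, map_smul, map_smul] at hz
    rw [smul_sub, smul_add, sub_eq_iff_eq_add, add_right_comm, ← sub_eq_iff_eq_add]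
    rw [sub_eq_iff_eq_add] at hz ⊢
    rw [hz]
    abel)
  let := fieldModule k s M'
  have := isScalarTower_fieldModule (k := k) (s := s) M'
  refine ⟨f, h.hom_ext ?_ ?_⟩
  · rw [LinearMap.comp_apply, hfξ, map_sub, hπι, sub_zero, hξg]
  · rw [LinearMap.comp_apply, hfη, map_add, hπι, add_zero, hηg]

/-- A finite product of pairwise orthogonal staircase modules is rigid. -/
theorem isRigid_pi {ι : Type} [Fintype ι] [DecidableEq ι] {X : ι → Type u}
    [∀ i, AddCommGroup (X i)] [∀ i, Module k (X i)] [∀ i, Module (NAlg k s) (X i)]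
    [∀ i, IsScalarTower k (NAlg k s) (X i)] {p q : ι → ℕ} {β : ∀ i, A2 → ℕ → X i}
    (h : ∀ i, Staircase k s (p i) (q i) (β i)) (hpq : ∀ i, q i < p i ∨ s ≤ q i)
    (hps : ∀ i, p i ≠ s) (horth : ∀ i j, Orthogonal s (p i) (q i) (p j) (q j)) :
    IsRigid k s (∀ i, X i) := by
  refine subsingleton_ext_of_split fun L _ _ π ι' hπ hι hex => ?_
  let := fieldModule k s L
  have := isScalarTower_fieldModule (k := k) (s := s) L
  -- Lifting each coordinate inclusion suffices: the lifts add up to a section of `π`.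
  have hlift : ∀ i, ∃ f : X i →ₗ[NAlg k s] L, π ∘ₗ f = LinearMap.single (NAlg k s) X i := by
    intro i
    refine exists_lift_of_staircase (h i) (hpq i) (hps i) (fun hp hp0 z hz => ?_) π hπ ι' hι hex _
    -- The kernel is itself the product, so the decomposition is chosen in each factor separately.
    choose z₁ z₂ h₁ h₂ hz' using fun j => exists_sum_of_orthogonal (h j) (hpq i) hp hp0
      (horth i j) (z := z j) (congrFun hz j)
    exact ⟨z₁, z₂, funext h₁, funext h₂, funext hz'⟩
  choose f hf using hlift
  refine ⟨∑ i, f i ∘ₗ LinearMap.proj i, ?_⟩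
  refine LinearMap.ext fun m => ?_
  rw [LinearMap.comp_apply, LinearMap.sum_apply, map_sum, LinearMap.id_apply]
  conv_rhs => rw [← Finset.univ_sum_single m]
  exact Finset.sum_congr rfl fun i _ => LinearMap.congr_fun (hf i) (m i)

end Rigid

/-! ### Combinatorics of the greedy algorithm. -/

section Greedy

variable {s : ℕ}

/-- The lists of summands obtained by running the greedy algorithm. -/
inductive GreedyRun : (Vertex s → ℕ) → List (Summand s) → Prop
  | done (δ : Vertex s → ℕ) (h : ∀ i, δ (.x, i) = 0) :
      GreedyRun δ ((List.finRange s).flatMap fun j =>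
        List.replicate (δ (.y, j)) (.delta (.y, j)))
  | pair (δ : Vertex s → ℕ) (i j : Fin s) (L : List (Summand s)) (hi : δ (.x, i) ≠ 0)
      (hmin : ∀ i', δ (.x, i') ≠ 0 → i ≤ i') (hji : j < i) (hj : δ (.y, j) ≠ 0)
      (hmax : ∀ j' < i, δ (.y, j') ≠ 0 → j' ≤ j)
      (h : GreedyRun (δ - Pi.single (.x, i) 1 - Pi.single (.y, j) 1) L) :
      GreedyRun δ (.E i j :: L)
  | single (δ : Vertex s → ℕ) (i : Fin s) (L : List (Summand s)) (hi : δ (.x, i) ≠ 0)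
      (hmin : ∀ i', δ (.x, i') ≠ 0 → i ≤ i') (hzero : ∀ j < i, δ (.y, j) = 0)
      (h : GreedyRun (δ - Pi.single (.x, i) 1) L) :
      GreedyRun δ (.delta (.x, i) :: L)

/-- The accumulator only contributes a prefix. Removing it, and turning `min'` and `max'` into
inequalities, makes rule induction on the run possible. -/
theorem greedy_eq (M : List (Summand s)) (δ : Vertex s → ℕ) :
    ∃ L, greedy M δ = M ++ L ∧ GreedyRun δ L := by
  induction M, δ using greedy.induct_unfolding with
  | case1 M δ h i h' j ih =>
    obtain ⟨L, hL, hrun⟩ := ih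
    have hi := (xSupport δ).min'_mem h
    have hj := (ySupportBelow δ i).max'_mem h'
    simp only [xSupport, ySupportBelow, Finset.mem_filter, Finset.mem_univ, true_and] at hi hj
    refine ⟨_, by rw [hL, List.append_assoc]; rfl, .pair δ i j L hi (fun i' hi' => ?_) hj.1 hj.2
      (fun j' hj' hne => ?_) hrun⟩
    · exact Finset.min'_le _ _ (by simpa [xSupport] using hi')
    · exact Finset.le_max' _ _ (by simpa [ySupportBelow] using ⟨hj', hne⟩)
  | case2 M δ h i h' ih =>
    obtain ⟨L, hL, hrun⟩ := ih
    have hi := (xSupport δ).min'_mem h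
    simp only [xSupport, Finset.mem_filter, Finset.mem_univ, true_and] at hi
    refine ⟨_, by rw [hL, List.append_assoc]; rfl, .single δ i L hi (fun i' hi' => ?_)
      (fun j hj => ?_) hrun⟩
    · exact Finset.min'_le _ _ (by simpa [xSupport] using hi')
    · by_contra hne
      exact h' ⟨j, by simpa [ySupportBelow] using ⟨hj, hne⟩⟩
  | case3 M δ h =>
    refine ⟨_, rfl, .done δ fun i => ?_⟩
    by_contra hne
    exact h ⟨i, by simpa [xSupport] using hne⟩

theorem greedyRun_greedy (δ : Vertex s → ℕ) : GreedyRun δ (greedy [] δ) := by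
  obtain ⟨L, hL, hrun⟩ := greedy_eq [] δ
  rwa [hL]

namespace GreedyRun

variable {δ : Vertex s → ℕ} {L : List (Summand s)}

theorem lt_of_E_mem (h : GreedyRun δ L) {i j : Fin s} (hE : .E i j ∈ L) : j < i := by
  induction h with
  | done δ h => simp at hE
  | pair δ i' j' L hi hmin hji hj hmax h ih =>
    rcases List.mem_cons.1 hE with e | e
    · cases e; exact hji
    · exact ih e
  | single δ i' L hi hmin hzero h ih =>
    rcases List.mem_cons.1 hE with e | e
    · cases e
    · exact ih e

/-- Later summands start where the current `δ` is non-zero, so they can be compared with the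
extremal choices made at this step. -/
theorem levels (h : GreedyRun δ L) {A : Summand s} (hA : A ∈ L) :
    (A.xStart = s + 1 ∨ ∃ i : Fin s, A.xStart = i ∧ δ (.x, i) ≠ 0) ∧
      (A.yStart = s ∨ ∃ j : Fin s, A.yStart = j ∧ δ (.y, j) ≠ 0) := by
  induction h with
  | done δ h =>
    simp only [List.mem_flatMap, List.mem_finRange, true_and, List.mem_replicate] at hA
    obtain ⟨j, hj, rfl⟩ := hA
    exact ⟨Or.inl rfl, Or.inr ⟨j, rfl, hj⟩⟩
  | pair δ i j L hi hmin hji hj hmax h ih =>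
    rcases List.mem_cons.1 hA with rfl | hA
    · exact ⟨Or.inr ⟨i, rfl, hi⟩, Or.inr ⟨j, rfl, hj⟩⟩
    · have hle : ∀ v, (δ - Pi.single (A2.x, i) 1 - Pi.single (A2.y, j) 1 : Vertex s → ℕ) v ≠ 0 → δ v ≠ 0 := by
        intro v hv h0
        simp [h0] at hv
      exact ⟨(ih hA).1.imp_right fun ⟨i, hi, h⟩ => ⟨i, hi, hle _ h⟩,
        (ih hA).2.imp_right fun ⟨i, hi, h⟩ => ⟨i, hi, hle _ h⟩⟩
  | single δ i L hi hmin hzero h ih =>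
    rcases List.mem_cons.1 hA with rfl | hA
    · exact ⟨Or.inr ⟨i, rfl, hi⟩, Or.inl rfl⟩
    · have hle : ∀ v, (δ - Pi.single (A2.x, i) 1 : Vertex s → ℕ) v ≠ 0 → δ v ≠ 0 := by
        intro v hv h0
        simp [h0] at hv
      exact ⟨(ih hA).1.imp_right fun ⟨i, hi, h⟩ => ⟨i, hi, hle _ h⟩,
        (ih hA).2.imp_right fun ⟨i, hi, h⟩ => ⟨i, hi, hle _ h⟩⟩

/-- Let the current summand start at `x_i`. Against any later summand `B`, a start `q' < i` of the
`y`-part gives `q' ≤ j` by maximality of `j`, and cannot occur if no `j` is available. In the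
opposite order, minimality of `i` gives `p' = i ≤ p`, or the current summand has no `y`-part. Once
only `Δ(y_j)` remain, `p < s` fails. -/
theorem orthogonal (h : GreedyRun δ L) : ∀ A ∈ L, ∀ B ∈ L,
    Orthogonal s A.xStart A.yStart B.xStart B.yStart := by
  induction h with
  | done δ h =>
    intro A hA B _
    simp only [List.mem_flatMap, List.mem_finRange, true_and, List.mem_replicate] at hA
    obtain ⟨j, hj, rfl⟩ := hA
    intro hlt
    simp only [Summand.xStart] at hlt
    omega
  | pair δ i j L hi hmin hji hj hmax h ih =>
    have hrun := GreedyRun.pair δ i j L hi hmin hji hj hmax h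
    intro A hA B hB
    rcases List.mem_cons.1 hA with rfl | hA'
    · intro _ hlt
      refine Or.inl ⟨j.2, ?_⟩
      rcases (hrun.levels hB).2 with e | ⟨j', e, hj'⟩
      · change B.yStart < i at hlt
        have := i.2
        omega
      · rw [e] at hlt ⊢
        exact hmax j' hlt hj'
    rcases List.mem_cons.1 hB with rfl | hB'
    · intro hlt _
      refine Or.inr ?_
      rcases (hrun.levels hA).1 with e | ⟨i', e, hi'⟩
      · omega
      · rw [e]
        exact hmin i' hi'
    · exact ih A hA' B hB'
  | single δ i L hi hmin hzero h ih =>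
    have hrun := GreedyRun.single δ i L hi hmin hzero h
    intro A hA B hB
    rcases List.mem_cons.1 hA with rfl | hA'
    · intro _ hlt
      change B.yStart < i at hlt
      rcases (hrun.levels hB).2 with e | ⟨j', e, hj'⟩
      · have := i.2
        omega
      · rw [e] at hlt
        exact absurd (hzero j' hlt) hj'
    rcases List.mem_cons.1 hB with rfl | hB'
    · intro hlt hlt'
      change s < A.xStart at hlt'
      omega
    · exact ih A hA' B hB'

end GreedyRun

/-- The additive extension of a function on standard modules to summands. -/
def Summand.weight (φ : Vertex s → ℕ) : Summand s → ℕ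
  | .delta v => φ v
  | .E i j => φ (.x, i) + φ (.y, j)

theorem sum_sub_single_mul {δ : Vertex s → ℕ} (φ : Vertex s → ℕ) {v : Vertex s} (h : δ v ≠ 0) :
    φ v + ∑ w, (δ - Pi.single v 1 : Vertex s → ℕ) w * φ w = ∑ w, δ w * φ w := by
  have : φ v = ∑ w, (Pi.single v 1 : Vertex s → ℕ) w * φ w := by
    simp [Pi.single_apply]
  rw [this, ← Finset.sum_add_distrib]
  refine Finset.sum_congr rfl fun w _ => ?_
  rw [← add_mul, Pi.sub_apply]
  congr 1
  rw [Pi.single_apply]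
  split_ifs with e
  · subst e; omega
  · omega

/-- The run conserves every additive quantity. With `φ` a dimension it gives the dimension vector of
the output, with `φ` an indicator function it counts the starting layers. -/
theorem GreedyRun.sum_weight {δ : Vertex s → ℕ} {L : List (Summand s)} (h : GreedyRun δ L)
    (φ : Vertex s → ℕ) : (L.map (Summand.weight φ)).sum = ∑ w, δ w * φ w := by
  induction h with
  | done δ h =>
    rw [Fintype.sum_prod_type, show (Finset.univ : Finset A2) = {A2.x, A2.y} from rfl,
      Finset.sum_pair (by simp)]
    simp only [h, zero_mul, Finset.sum_const_zero, zero_add]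
    rw [List.map_flatMap, List.flatMap, List.sum_flatten, List.map_map,
      Fin.sum_univ_def]
    congr 1
    refine List.map_congr_left fun j _ => ?_
    simp [Summand.weight]
  | pair δ i j L hi hmin hji hj hmax h ih =>
    rw [List.map_cons, List.sum_cons, ih, Summand.weight, add_assoc,
      sum_sub_single_mul φ (by simpa using hj), sum_sub_single_mul φ hi]
  | single δ i L hi hmin hzero h ih =>
    rw [List.map_cons, List.sum_cons, ih, Summand.weight, sum_sub_single_mul φ hi]

end Greedy

/-! ### From infinitesimal transitivity to Zariski density. -/

section Density

open Polynomial in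
/-- A representation whose infinitesimal orbit is everything has a Zariski dense orbit. -/
theorem eval_eq_zero_of_infinitesimally_transitive {k : Type u} [Field k] [Infinite k]
    {m n : Type} [Fintype m] [Fintype n] [DecidableEq m] [DecidableEq n]
    (W : Submodule k (Matrix n n k × Matrix m m k)) (R : Submodule k (Matrix m n k))
    (hone : (1, 1) ∈ W) (hleft : ∀ w ∈ W, ∀ N ∈ R, w.2 * N ∈ R)
    (hright : ∀ w ∈ W, ∀ N ∈ R, N * w.1 ∈ R) {M : Matrix m n k} (hM : M ∈ R)
    (htrans : ∀ ψ ∈ R, ∃ w ∈ W, w.2 * M - M * w.1 = ψ) {f : MvPolynomial (m × n) k}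
    (hf : ∀ w ∈ W, IsUnit w.1.det → IsUnit w.2.det → ∀ N : Matrix m n k, w.2 * M = N * w.1 →
      MvPolynomial.eval (fun p => N p.1 p.2) f = 0) {N : Matrix m n k} (hN : N ∈ R) :
    MvPolynomial.eval (fun p => N p.1 p.2) f = 0 := by
  let θ : W →ₗ[k] R :=
    { toFun := fun w => ⟨w.1.2 * M - M * w.1.1, R.sub_mem (hleft _ w.2 _ hM) (hright _ w.2 _ hM)⟩
      map_add' := fun w w' => Subtype.ext (by simp [Matrix.add_mul, Matrix.mul_add]; abel)
      map_smul' := fun c w => Subtype.ext (by simp [smul_sub]) }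
  have hθ : LinearMap.range θ = ⊤ := LinearMap.range_eq_top.2 fun ψ => by
    obtain ⟨w, hw, e⟩ := htrans ψ.1 ψ.2
    exact ⟨⟨w, hw⟩, Subtype.ext e⟩
  -- A linear section `σ` turns the task into linear algebra on `R`: to have `h M = (M - tρ) g` with
  -- `(g, h) = δ • 1 - t • σ ψ`, it suffices that `(1 + tτ) ψ = δ ρ`, where `τ ψ = ρ (σ ψ)₁`.
  obtain ⟨σ, hσ⟩ := θ.exists_rightInverse_of_surjective hθ
  let ρ : R := ⟨M - N, R.sub_mem hM hN⟩
  let τ : R →ₗ[k] R :=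
    { toFun := fun ψ => ⟨ρ.1 * (σ ψ).1.1, hright _ (σ ψ).2 _ ρ.2⟩
      map_add' := fun w w' => Subtype.ext (by simp [Matrix.mul_add])
      map_smul' := fun c w => Subtype.ext (by simp) }
  let b := Module.finBasis k R
  let T := LinearMap.toMatrix b b τ
  -- Cramer's rule solves this with `δ = det A` and `ψ` given by the adjugate, both polynomial in
  -- `t`.
  let A : Matrix (Fin (Module.finrank k R)) (Fin (Module.finrank k R)) k[X] :=
    1 + (X : k[X]) • T.map C
  let Z : Fin (Module.finrank k R) → k[X] := A.adjugate.mulVec fun l => C (b.repr ρ l)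
  have hAZ : ∀ t : k, (b.equivFun.symm (fun l => (Z l).eval t) : R) +
      t • τ (b.equivFun.symm fun l => (Z l).eval t) =
        A.det.eval t • ρ := by
    intro t
    set ψ : R := b.equivFun.symm fun l => (Z l).eval t with hψ
    have hrepr : ∀ l, b.repr ψ l = (Z l).eval t := fun l =>
      congrFun (b.equivFun.apply_symm_apply fun l => (Z l).eval t) l
    have hA : A.mulVec Z = A.det • fun l => C (b.repr ρ l) := by
      simp only [Z]
      rw [Matrix.mulVec_mulVec, Matrix.mul_adjugate, Matrix.smul_mulVec, Matrix.one_mulVec]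
    refine b.repr.injective (Finsupp.ext fun l => ?_)
    have hl := congrArg (eval t) (congrFun hA l)
    have hT : b.repr (τ ψ) l = ∑ l', T l l' * (Z l').eval t := by
      have := congrFun (LinearMap.toMatrix_mulVec_repr b b τ ψ) l
      rw [← this]
      simp [Matrix.mulVec, dotProduct, hrepr, T]
    simp only [A, Matrix.add_mulVec, Matrix.one_mulVec, Matrix.smul_mulVec, Pi.add_apply,
      Pi.smul_apply, smul_eq_mul, eval_add, eval_mul, eval_X, eval_C] at hl
    simp only [map_add, map_smul, Finsupp.add_apply, Finsupp.smul_apply, smul_eq_mul, hrepr, hT]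
    rw [← hl]
    simp [Matrix.mulVec, dotProduct, eval_finsetSum]
  -- The polynomial family of group elements.
  let y : k → W := fun t => ∑ l, (Z l).eval t • σ (b l)
  have hy : ∀ t, y t = σ (b.equivFun.symm fun l => (Z l).eval t) := by
    intro t
    rw [Module.Basis.equivFun_symm_apply]
    simp [y, map_sum]
  let w : k → W := fun t => A.det.eval t • ⟨(1, 1), hone⟩ - t • y t
  have hw : ∀ t, (w t).1.2 * M = (M - t • ρ.1) * (w t).1.1 := by
    intro t
    have h1 := congrArg Subtype.val (hAZ t)
    have h2 := congrArg Subtype.val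
      (LinearMap.congr_fun hσ (b.equivFun.symm fun l => (Z l).eval t))
    simp only [LinearMap.comp_apply, LinearMap.id_apply] at h2
    rw [Submodule.coe_add, ← h2, Submodule.coe_smul, Submodule.coe_smul] at h1
    simp only [θ, τ, LinearMap.coe_mk, AddHom.coe_mk, ← hy] at h1
    have e1 : (w t).1.1 = A.det.eval t • 1 - t • (y t).1.1 := rfl
    have e2 : (w t).1.2 = A.det.eval t • 1 - t • (y t).1.2 := rfl
    rw [e1, e2]
    simp only [Matrix.sub_mul, Matrix.mul_sub, Matrix.smul_mul, Matrix.mul_smul, Matrix.one_mul,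
      Matrix.mul_one]
    have h3 := congrArg (fun z => t • z) h1
    simp only [smul_add, smul_sub] at h3
    rw [smul_comm t (eval t A.det) ρ.1] at h3
    rw [← sub_eq_zero] at h3 ⊢
    rw [← neg_eq_zero, ← h3]
    simp only [smul_sub]
    abel
  -- The two group components as polynomial matrices. They are the identity at `t = 0`, so their
  -- determinants are non-zero polynomials.
  let G : Matrix n n k[X] := A.det • 1 - (X : k[X]) • ∑ l, Z l • (σ (b l)).1.1.map C
  let H : Matrix m m k[X] := A.det • 1 - (X : k[X]) • ∑ l, Z l • (σ (b l)).1.2.map C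
  have hG : ∀ t, G.det.eval t = (w t).1.1.det := by
    intro t
    rw [← coe_evalRingHom, RingHom.map_det]
    congr 1
    ext i j
    have : (w t).1.1 = A.det.eval t • 1 - t • ∑ l, (Z l).eval t • (σ (b l)).1.1 := by
      simp [w, y, Prod.fst_sum]
    rw [this]
    simp [G, Matrix.sum_apply, eval_finsetSum, Matrix.one_apply, apply_ite (eval t)]
  have hH : ∀ t, H.det.eval t = (w t).1.2.det := by
    intro t
    rw [← coe_evalRingHom, RingHom.map_det]
    congr 1
    ext i j
    have : (w t).1.2 = A.det.eval t • 1 - t • ∑ l, (Z l).eval t • (σ (b l)).1.2 := by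
      simp [w, y, Prod.snd_sum]
    rw [this]
    simp [H, Matrix.sum_apply, eval_finsetSum, Matrix.one_apply, apply_ite (eval t)]
  have hA0 : A.det.eval 0 = 1 := by
    rw [← coe_evalRingHom, RingHom.map_det]
    have : (evalRingHom 0).mapMatrix A = 1 := by
      ext i j
      simp [A, Matrix.one_apply, apply_ite (eval (0 : k))]
    rw [this, Matrix.det_one]
  have hw0 : (w 0).1 = (1, 1) := by simp [w, hA0]
  have hG0 : G.det ≠ 0 := fun h => by
    have := hG 0
    rw [h, hw0] at this
    simp at this
  have hH0 : H.det ≠ 0 := fun h => by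
    have := hH 0
    rw [h, hw0] at this
    simp at this
  let Q : k[X] := MvPolynomial.aeval (fun p : m × n => C (M p.1 p.2) - X * C (ρ.1 p.1 p.2)) f
  have hQ : ∀ t, Q.eval t = MvPolynomial.eval (fun p => (M - t • ρ.1) p.1 p.2) f := by
    intro t
    have : (evalRingHom t).comp (MvPolynomial.aeval
        (fun p : m × n => (C (M p.1 p.2) - X * C (ρ.1 p.1 p.2) : k[X]))).toRingHom =
        MvPolynomial.eval (fun p => (M - t • ρ.1) p.1 p.2) :=
      MvPolynomial.ringHom_ext (fun r => by simp) (fun p => by simp; ring)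
    exact RingHom.congr_fun this f
  -- Wherever both determinants are non-zero, `M - tρ` lies in the orbit and `f` vanishes. As `k` is
  -- infinite, `f` vanishes identically on the line, in particular at `t = 1`, which is `N`.
  have hzero : Q * (G.det * H.det) = 0 := by
    refine Polynomial.funext fun t => ?_
    rw [eval_mul, eval_mul, hG, hH, hQ, eval_zero]
    by_cases h1 : (w t).1.1.det = 0
    · rw [h1]; ring
    by_cases h2 : (w t).1.2.det = 0
    · rw [h2]; ring
    rw [hf _ (w t).2 (Ne.isUnit h1) (Ne.isUnit h2) _ (hw t), zero_mul]
  have hQ0 : Q = 0 := (mul_eq_zero.1 hzero).resolve_right (mul_ne_zero hG0 hH0)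
  have := hQ 1
  rw [hQ0, eval_zero] at this
  simpa [ρ] using this.symm

end Density

/-! ### Bases adapted to a flag. -/

section Flags

variable {k : Type u} [Field k] {V : Type u} [AddCommGroup V] [Module k V] [FiniteDimensional k V]

/-- At each layer a complement of the previous space inside the next one is chosen. By the counting
hypothesis, its dimension is the number of indices assigned to that layer. -/
theorem exists_partial_adapted {s : ℕ} (F : Fin s → Submodule k V) (hF : Monotone F)
    {I : Type} [Fintype I] (l : I → Fin s)
    (hcard : ∀ t, (Finset.univ.filter fun i => l i ≤ t).card = Module.finrank k (F t)) (r : ℕ)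
    (hr : r ≤ s) : ∃ v : I → V, LinearIndepOn k v {i | (l i : ℕ) < r} ∧
      ∀ t : Fin s, (t : ℕ) < r → Submodule.span k (v '' {i | l i ≤ t}) = F t := by
  induction r with
  | zero => exact ⟨fun _ => 0, by simp, fun t ht => absurd ht (by omega)⟩
  | succ r ih =>
    classical
    obtain ⟨v, hind, hspan⟩ := ih (by omega)
    let t₀ : Fin s := ⟨r, hr⟩
    set A := Submodule.span k (v '' {i | (l i : ℕ) < r}) with hA
    have hAle : A ≤ F t₀ := by
      rw [hA, Submodule.span_le]
      rintro _ ⟨i, hi, rfl⟩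
      refine hF (show l i ≤ t₀ from Fin.le_def.2 (le_of_lt hi)) ?_
      rw [← hspan (l i) hi]
      exact Submodule.subset_span ⟨i, le_refl (l i), rfl⟩
    obtain ⟨C', hC'⟩ := A.exists_isCompl
    set C := C' ⊓ F t₀ with hC
    have hsup : A ⊔ C = F t₀ := by
      rw [hC, ← sup_inf_assoc_of_le C' hAle, hC'.sup_eq_top, top_inf_eq]
    have hinf : Disjoint A C := hC'.disjoint.mono_right inf_le_left
    have hfinA : Module.finrank k A = (Finset.univ.filter fun i => (l i : ℕ) < r).card := by
      have := finrank_span_eq_card hind.linearIndependent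
      rw [show (Set.range fun i : {i | (l i : ℕ) < r} => v i) = v '' {i | (l i : ℕ) < r} from
        (Set.image_eq_range _ _).symm] at this
      refine this.trans ?_
      rw [Fintype.card_subtype]
      rfl
    have hfinC : Module.finrank k C = (Finset.univ.filter fun i => l i = t₀).card := by
      have h1 := Submodule.finrank_sup_add_finrank_inf_eq A C
      rw [hsup, hinf.eq_bot, finrank_bot, hfinA, ← hcard] at h1
      have h2 : (Finset.univ.filter fun i => l i ≤ t₀) =
          (Finset.univ.filter fun i => (l i : ℕ) < r) ∪ (Finset.univ.filter fun i => l i = t₀) := by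
        ext i
        simp [Fin.le_def, Fin.ext_iff, t₀]
        omega
      rw [h2, Finset.card_union_of_disjoint] at h1
      · omega
      · rw [Finset.disjoint_filter]
        intro i _ hi e
        rw [e] at hi
        exact lt_irrefl _ hi
    let b : Module.Basis {i // l i = t₀} k C := (Module.finBasis k C).reindex
      (Fintype.equivOfCardEq (by rw [Fintype.card_fin, hfinC, Fintype.card_subtype]))
    let v' : I → V := fun i => if h : l i = t₀ then b ⟨i, h⟩ else v i
    have hv'old : ∀ i, (l i : ℕ) < r → v' i = v i := fun i hi =>
      dif_neg fun e => by rw [e] at hi; exact lt_irrefl _ hi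
    have hv'new : ∀ (i : I) (h : l i = t₀), v' i = b ⟨i, h⟩ := fun i h => dif_pos h
    have himold : ∀ S : Set I, (∀ i ∈ S, (l i : ℕ) < r) → v' '' S = v '' S := fun S hS =>
      Set.image_congr fun i hi => hv'old i (hS i hi)
    have himnew : v' '' {i | l i = t₀} = Set.range fun i => (b i : V) := by
      ext z
      constructor
      · rintro ⟨i, hi, rfl⟩
        exact ⟨⟨i, hi⟩, (hv'new i hi).symm⟩
      · rintro ⟨⟨i, hi⟩, rfl⟩
        exact ⟨i, hi, hv'new i hi⟩
    have hspannew : Submodule.span k (v' '' {i | l i = t₀}) = C := by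
      rw [himnew, show (Set.range fun i => (b i : V)) = C.subtype '' Set.range b by
        rw [← Set.range_comp]; rfl, Submodule.span_image, b.span_eq, Submodule.map_subtype_top]
    have hset : {i | (l i : ℕ) < r + 1} = {i | (l i : ℕ) < r} ∪ {i | l i = t₀} := by
      ext i
      simp [Fin.ext_iff, t₀]
      omega
    have hle : {i | l i ≤ t₀} = {i | (l i : ℕ) < r} ∪ {i | l i = t₀} := by
      rw [← hset]
      ext i
      simp [Fin.le_def, t₀]
    refine ⟨v', ?_, fun t ht => ?_⟩
    · rw [hset]
      refine LinearIndepOn.union ?_ ?_ ?_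
      · exact hind.congr fun i hi => (hv'old i hi).symm
      · have : LinearIndependent k fun i : {i // l i = t₀} => (b i : V) :=
          b.linearIndependent.map' C.subtype (Submodule.ker_subtype C)
        rw [show (fun i : {i // l i = t₀} => (b i : V)) = fun i => v' i.1 from
          funext fun i => (hv'new i.1 i.2).symm] at this
        exact this
      · rw [hspannew, himold {i | (l i : ℕ) < r} fun i hi => hi]
        exact hinf
    · rcases Nat.lt_succ_iff_lt_or_eq.1 ht with ht | ht
      · rw [himold, hspan t ht]
        exact fun i hi => lt_of_le_of_lt (Fin.le_def.1 hi) ht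
      · obtain rfl : t = t₀ := Fin.ext ht
        rw [hle, Set.image_union, Submodule.span_union, hspannew, himold {i | (l i : ℕ) < r} fun i hi => hi, ← hA,
          hsup]

/-- A flag has an adapted basis, with prescribed indices of the basis vectors. -/
theorem exists_adapted_basis {s : ℕ} [NeZero s] (F : Fin s → Submodule k V) (hF : Monotone F)
    (htop : F ⊤ = ⊤) {I : Type} [Fintype I] (l : I → Fin s)
    (hcard : ∀ t, (Finset.univ.filter fun i => l i ≤ t).card = Module.finrank k (F t)) :
    ∃ v : Module.Basis I k V, ∀ t, F t = Submodule.span k (v '' {i | l i ≤ t}) := by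
  obtain ⟨v, hind, hspan⟩ := exists_partial_adapted F hF l hcard s le_rfl
  have h1 : {i | (l i : ℕ) < s} = Set.univ := Set.eq_univ_of_forall fun i => (l i).2
  rw [h1, linearIndepOn_univ_iff] at hind
  have h2 := hspan ⊤ (⊤ : Fin s).2
  rw [show {i | l i ≤ ⊤} = Set.univ from Set.eq_univ_of_forall fun i => (le_top : l i ≤ ⊤), Set.image_univ,
    htop] at h2
  refine ⟨Module.Basis.mk hind h2.ge, fun t => ?_⟩
  rw [Module.Basis.coe_mk, hspan t t.2]

end Flags

/-! ### Orbits of the parabolic group. -/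

section Richardson

variable {k : Type u} [Field k] {s : ℕ} [NeZero s]

/-- The space of representations compatible with a flag, as a subspace. -/
def repFlagSubmodule (d : Vertex s → ℕ) (F : Flags k d) :
    Submodule k (Matrix (Fin (d (.y, ⊤))) (Fin (d (.x, ⊤))) k) where
  carrier := repFlag d F
  zero_mem' := by simp [repFlag]
  add_mem' {M N} hM hN := by
    refine ⟨fun t ht v hv => ?_, fun t u htu v hv => ?_⟩
    · rw [Matrix.add_mulVec, hM.1 t ht v hv, hN.1 t ht v hv, add_zero]
    · rw [Matrix.add_mulVec]
      exact Submodule.add_mem _ (hM.2 t u htu v hv) (hN.2 t u htu v hv)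
  smul_mem' r M hM := by
    refine ⟨fun t ht v hv => ?_, fun t u htu v hv => ?_⟩
    · rw [Matrix.smul_mulVec, hM.1 t ht v hv, smul_zero]
    · rw [Matrix.smul_mulVec]
      exact Submodule.smul_mem _ _ (hM.2 t u htu v hv)

/-- The pairs of matrices that stabilise a flag. -/
def flagSubmodule (d : Vertex s → ℕ) (F : Flags k d) :
    Submodule k (Matrix (Fin (d (.x, ⊤))) (Fin (d (.x, ⊤))) k ×
      Matrix (Fin (d (.y, ⊤))) (Fin (d (.y, ⊤))) k) where
  carrier := {w | (∀ t, ∀ v ∈ F .x t, w.1.mulVec v ∈ F .x t) ∧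
    ∀ t, ∀ v ∈ F .y t, w.2.mulVec v ∈ F .y t}
  zero_mem' := by simp
  add_mem' {w w'} h h' := by
    refine ⟨fun t v hv => ?_, fun t v hv => ?_⟩
    · rw [Prod.fst_add, Matrix.add_mulVec]
      exact Submodule.add_mem _ (h.1 t v hv) (h'.1 t v hv)
    · rw [Prod.snd_add, Matrix.add_mulVec]
      exact Submodule.add_mem _ (h.2 t v hv) (h'.2 t v hv)
  smul_mem' r w h := by
    refine ⟨fun t v hv => ?_, fun t v hv => ?_⟩
    · rw [Prod.smul_fst, Matrix.smul_mulVec]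
      exact Submodule.smul_mem _ _ (h.1 t v hv)
    · rw [Prod.smul_snd, Matrix.smul_mulVec]
      exact Submodule.smul_mem _ _ (h.2 t v hv)

theorem mul_mem_repFlag {d : Vertex s → ℕ} {F : Flags k d}
    {w : Matrix (Fin (d (.x, ⊤))) (Fin (d (.x, ⊤))) k ×
      Matrix (Fin (d (.y, ⊤))) (Fin (d (.y, ⊤))) k} (hw : w ∈ flagSubmodule d F)
    {N : Matrix (Fin (d (.y, ⊤))) (Fin (d (.x, ⊤))) k} (hN : N ∈ repFlagSubmodule d F) :
    w.2 * N ∈ repFlagSubmodule d F ∧ N * w.1 ∈ repFlagSubmodule d F := by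
  refine ⟨⟨fun t ht v hv => ?_, fun t u htu v hv => ?_⟩,
    ⟨fun t ht v hv => ?_, fun t u htu v hv => ?_⟩⟩
  all_goals rw [← Matrix.mulVec_mulVec]
  · rw [hN.1 t ht v hv, Matrix.mulVec_zero]
  · exact hw.2 u _ (hN.2 t u htu v hv)
  · exact hN.1 t ht _ (hw.1 t v hv)
  · exact hN.2 t u htu _ (hw.1 t v hv)

/-- An infinitesimally transitive point has a dense orbit. -/
theorem hasRichardsonOrbit_of_transitive [Infinite k] {d : Vertex s → ℕ} {F : Flags k d}
    {M : Matrix (Fin (d (.y, ⊤))) (Fin (d (.x, ⊤))) k} (hM : M ∈ repFlagSubmodule d F)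
    (htrans : ∀ ψ ∈ repFlagSubmodule d F, ∃ w ∈ flagSubmodule d F, w.2 * M - M * w.1 = ψ) :
    HasRichardsonOrbit d F := by
  refine ⟨M, hM, fun f hf N hN => ?_⟩
  refine eval_eq_zero_of_infinitesimally_transitive (flagSubmodule d F) (repFlagSubmodule d F)
    ⟨fun t v hv => by simpa using hv, fun t v hv => by simpa using hv⟩
    (fun w hw N hN => (mul_mem_repFlag hw hN).1) (fun w hw N hN => (mul_mem_repFlag hw hN).2)
    hM htrans (fun w hw h1 h2 N' hN' => ?_) hN
  refine hf N' ⟨Matrix.GeneralLinearGroup.mk'' w.1 h1, hw.1,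
    Matrix.GeneralLinearGroup.mk'' w.2 h2, hw.2, ?_⟩
  change N' = w.2 * M * (Matrix.GeneralLinearGroup.mk'' w.1 h1)⁻¹.val
  rw [hN']
  have : w.1 * (Matrix.GeneralLinearGroup.mk'' w.1 h1)⁻¹.val = 1 :=
    (Matrix.GeneralLinearGroup.mk'' w.1 h1).mul_inv
  rw [Matrix.mul_assoc, this, Matrix.mul_one]

/-- A linear map preserves a flag if it does so on an adapted basis. -/
theorem map_mem_flag {V V' I : Type*} [AddCommGroup V] [Module k V] [AddCommGroup V'] [Module k V']
    {v : I → V} {S : Set I} {g : V →ₗ[k] V'} {U : Submodule k V'} (h : ∀ i ∈ S, g (v i) ∈ U)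
    {z : V} (hz : z ∈ Submodule.span k (v '' S)) : g z ∈ U := by
  have : Submodule.span k (v '' S) ≤ U.comap g := by
    rw [Submodule.span_le]
    rintro _ ⟨i, hi, rfl⟩
    exact h i hi
  exact this hz

/-- A matching of adapted bases with the orthogonality property defines a representation with a
dense orbit. -/
theorem hasRichardsonOrbit_of_bases [Infinite k] {d : Vertex s → ℕ} {F : Flags k d}
    {Λ : Type} [Fintype Λ] {p q : Λ → ℕ}
    (hvalid : ∀ n, q n < p n ∨ s ≤ q n)
    (horth : ∀ n m, Orthogonal s (p n) (q n) (p m) (q m))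
    (v : Module.Basis {n // p n < s} k (Fin (d (.x, ⊤)) → k))
    (w : Module.Basis {n // q n < s} k (Fin (d (.y, ⊤)) → k))
    (hv : ∀ t, F .x t = Submodule.span k (v '' {n | p n.1 ≤ t}))
    (hw : ∀ t, F .y t = Submodule.span k (w '' {n | q n.1 ≤ t})) :
    HasRichardsonOrbit d F := by
  classical
  -- The representation underlying the sum of staircases: the `x`-vector of a summand goes to its
  -- `y`-vector, if there is one.
  let μ : (Fin (d (.x, ⊤)) → k) →ₗ[k] (Fin (d (.y, ⊤)) → k) :=
    v.constr k fun n => if h : q n.1 < s then w ⟨n, h⟩ else 0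
  have hμ : ∀ n, μ (v n) = if h : q n.1 < s then w ⟨n, h⟩ else 0 := fun n =>
    v.constr_basis k _ n
  have hvmem : ∀ (n : {n // p n < s}) (t : Fin s), p n.1 ≤ t → v n ∈ F .x t := fun n t ht => by
    rw [hv]
    exact Submodule.subset_span ⟨n, ht, rfl⟩
  have hwmem : ∀ (n : {n // q n < s}) (t : Fin s), q n.1 ≤ t → w n ∈ F .y t := fun n t ht => by
    rw [hw]
    exact Submodule.subset_span ⟨n, ht, rfl⟩
  have hM : LinearMap.toMatrix' μ ∈ repFlagSubmodule d F := by
    refine ⟨fun t ht z hz => ?_, fun t u htu z hz => ?_⟩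
    · rw [LinearMap.toMatrix'_mulVec]
      rw [hv] at hz
      rw [← Submodule.mem_bot k]
      refine map_mem_flag (fun n hn => ?_) hz
      rw [hμ, dif_neg]
      · exact Submodule.zero_mem _
      · have hn' : p n.1 ≤ t := hn
        have := hvalid n.1
        omega
    · rw [LinearMap.toMatrix'_mulVec]
      rw [hv] at hz
      refine map_mem_flag (fun n hn => ?_) hz
      have hn' : p n.1 ≤ t := hn
      rw [hμ]
      split_ifs with hq
      · refine hwmem _ _ ?_
        have := hvalid n.1
        simp only
        omega
      · exact Submodule.zero_mem _
  refine hasRichardsonOrbit_of_transitive hM fun ψ hψ => ?_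
  -- The coordinates of a representation vanish unless the layers decrease.
  have hcoord : ∀ (n : {n // p n < s}) (m : {n // q n < s}),
      w.repr (ψ.mulVec (v n)) m ≠ 0 → q m.1 < p n.1 := by
    intro n m hne
    by_contra hle
    apply hne
    obtain ⟨n, hn⟩ := n
    cases hpn : p n with
    | zero =>
      rw [hψ.1 ⟨p n, hn⟩ hpn _ (hvmem ⟨n, hn⟩ _ (le_refl (p n))), map_zero, Finsupp.zero_apply]
    | succ r =>
      have := hψ.2 ⟨p n, hn⟩ ⟨r, by omega⟩ hpn.symm _ (hvmem ⟨n, hn⟩ _ (le_refl (p n)))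
      rw [hw, Module.Basis.mem_span_image] at this
      by_contra hne'
      have hm := this (Finsupp.mem_support_iff.2 hne')
      change q m.1 ≤ r at hm
      simp only at hle
      omega
  -- Each coefficient of `ψ (v n)` at `w m` is absorbed once: by `h`, through `w n ↦ w m`, when `q m
  -- ≤ q n < s`, and otherwise by `g`, through `v n ↦ v m`, which orthogonality permits. The
  -- inequalities on layers keep both maps compatible with the flags.
  let g : (Fin (d (.x, ⊤)) → k) →ₗ[k] (Fin (d (.x, ⊤)) → k) := v.constr k fun n =>
    -∑ m : {n // q n < s}, if h : p m.1 < s then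
      (if ¬ (q n.1 < s ∧ q m.1 ≤ q n.1) ∧ p m.1 ≤ p n.1 then
        w.repr (ψ.mulVec (v n)) m • v ⟨m, h⟩ else 0) else 0
  let h : (Fin (d (.y, ⊤)) → k) →ₗ[k] (Fin (d (.y, ⊤)) → k) := w.constr k fun n =>
    if hp : p n.1 < s then ∑ m : {n // q n < s},
      (if q m.1 ≤ q n.1 then w.repr (ψ.mulVec (v ⟨n, hp⟩)) m • w m else 0) else 0
  have hg : ∀ n, g (v n) = -∑ m : {n // q n < s}, if h : p m.1 < s then
      (if ¬ (q n.1 < s ∧ q m.1 ≤ q n.1) ∧ p m.1 ≤ p n.1 then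
        w.repr (ψ.mulVec (v n)) m • v ⟨m, h⟩ else 0) else 0 := fun n => v.constr_basis k _ n
  have hh : ∀ n, h (w n) = if hp : p n.1 < s then ∑ m : {n // q n < s},
      (if q m.1 ≤ q n.1 then w.repr (ψ.mulVec (v ⟨n, hp⟩)) m • w m else 0) else 0 := fun n =>
    w.constr_basis k _ n
  refine ⟨(LinearMap.toMatrix' g, LinearMap.toMatrix' h), ⟨fun t z hz => ?_, fun t z hz => ?_⟩, ?_⟩
  · rw [LinearMap.toMatrix'_mulVec]
    rw [hv] at hz
    refine map_mem_flag (fun n hn => ?_) hz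
    have hn' : p n.1 ≤ t := hn
    rw [hg]
    refine Submodule.neg_mem _ (Submodule.sum_mem _ fun m _ => ?_)
    split_ifs with h1 h2
    · exact Submodule.smul_mem _ _ (hvmem _ _ (h2.2.trans hn'))
    all_goals exact Submodule.zero_mem _
  · rw [LinearMap.toMatrix'_mulVec]
    rw [hw] at hz
    refine map_mem_flag (fun n hn => ?_) hz
    have hn' : q n.1 ≤ t := hn
    rw [hh]
    split_ifs with h1
    · refine Submodule.sum_mem _ fun m _ => ?_
      split_ifs with h2
      · exact Submodule.smul_mem _ _ (hwmem _ _ (h2.trans hn'))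
      · exact Submodule.zero_mem _
    · exact Submodule.zero_mem _
  · have key : h ∘ₗ μ - μ ∘ₗ g = Matrix.toLin' ψ := by
      refine v.ext fun n => ?_
      rw [LinearMap.sub_apply, LinearMap.comp_apply, LinearMap.comp_apply, hμ, hg,
        Matrix.toLin'_apply, map_neg, map_sum, sub_neg_eq_add]
      have h1 : h (if h : q n.1 < s then w ⟨n, h⟩ else 0) = ∑ m : {n // q n < s},
          if q n.1 < s ∧ q m.1 ≤ q n.1 then w.repr (ψ.mulVec (v n)) m • w m else 0 := by
        split_ifs with hq
        · rw [hh, dif_pos n.2]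
          simp [hq]
        · simp [hq]
      rw [h1, ← Finset.sum_add_distrib]
      refine Eq.trans (Finset.sum_congr rfl fun m _ => ?_) (w.sum_repr (ψ.mulVec (v n)))
      by_cases h0 : w.repr (ψ.mulVec (v n)) m = 0
      · simp [h0]
      by_cases hA : q n.1 < s ∧ q m.1 ≤ q n.1
      · simp [hA]
      · have hle : p m.1 ≤ p n.1 :=
          (horth n.1 m.1 n.2 (hcoord n m h0)).resolve_left hA
        have hps : p m.1 < s := hle.trans_lt n.2
        rw [if_neg hA, zero_add, dif_pos hps, if_pos ⟨hA, hle⟩, map_smul, hμ, dif_pos m.2]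
    have := congrArg LinearMap.toMatrix' key
    rw [map_sub, LinearMap.toMatrix'_comp, LinearMap.toMatrix'_comp, LinearMap.toMatrix'_toLin']
      at this
    exact this

end Richardson

/-! ### The output of the algorithm and the dense orbit. -/

section Output

variable {k : Type u} [Field k] {s : ℕ}

theorem sum_get_eq {α : Type} (L : List α) (φ : α → ℕ) :
    ∑ n : Fin L.length, φ (L.get n) = (L.map φ).sum := by
  rw [← List.sum_ofFn]
  congr 1
  exact (List.map_ofFn ..).symm.trans (by rw [List.ofFn_get])

theorem Summand.valid_of_mem {δ : Vertex s → ℕ} {A : Summand s} (hA : A ∈ greedy [] δ) :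
    A.yStart < A.xStart ∨ s ≤ A.yStart := by
  cases A with
  | delta v => exact Summand.delta_valid v
  | E i j => exact Or.inl ((greedyRun_greedy δ).lt_of_E_mem hA)

theorem Summand.xStart_ne (A : Summand s) : A.xStart ≠ s := by
  cases A with
  | delta v =>
    obtain ⟨c, t⟩ := v
    cases c
    · exact t.2.ne
    · simp [Summand.xStart]
  | E i j => exact i.2.ne

/-- Apply conservation of weights to the indicator of the `x`-vertices up to layer `t`; the
placeholder `s + 1` is never counted. -/
theorem card_xStart_le (L : List (Summand s)) {δ : Vertex s → ℕ} (h : GreedyRun δ L) (t : Fin s) :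
    (Finset.univ.filter fun n : Fin L.length => (L.get n).xStart ≤ t).card =
      ∑ u ∈ Finset.univ.filter (· ≤ t), δ (.x, u) := by
  rw [Finset.card_filter, sum_get_eq L fun A => if A.xStart ≤ t then 1 else 0]
  have := h.sum_weight fun v => if v.1 = .x ∧ v.2 ≤ t then 1 else 0
  rw [Fintype.sum_prod_type, show (Finset.univ : Finset A2) = {A2.x, A2.y} from rfl,
    Finset.sum_pair (by simp)] at this
  simp only [true_and, reduceCtorEq, false_and, if_false, mul_zero, Finset.sum_const_zero,
    add_zero, mul_ite, mul_one] at this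
  rw [Finset.sum_filter, ← this]
  congr 1
  refine List.map_congr_left fun A _ => ?_
  cases A with
  | delta v =>
    obtain ⟨c, u⟩ := v
    cases c
    · simp [Summand.xStart, Summand.weight]
    · have := t.2
      rw [if_neg (show ¬ (Summand.delta (.y, u)).xStart ≤ t by simp only [Summand.xStart]; omega)]
      simp [Summand.weight]
  | E i j => simp [Summand.xStart, Summand.weight]

theorem card_yStart_le (L : List (Summand s)) {δ : Vertex s → ℕ} (h : GreedyRun δ L) (t : Fin s) :
    (Finset.univ.filter fun n : Fin L.length => (L.get n).yStart ≤ t).card =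
      ∑ u ∈ Finset.univ.filter (· ≤ t), δ (.y, u) := by
  rw [Finset.card_filter, sum_get_eq L fun A => if A.yStart ≤ t then 1 else 0]
  have := h.sum_weight fun v => if v.1 = .y ∧ v.2 ≤ t then 1 else 0
  rw [Fintype.sum_prod_type, show (Finset.univ : Finset A2) = {A2.x, A2.y} from rfl,
    Finset.sum_pair (by simp)] at this
  simp only [true_and, reduceCtorEq, false_and, if_false, mul_zero, Finset.sum_const_zero,
    zero_add, mul_ite, mul_one] at this
  rw [Finset.sum_filter, ← this]
  congr 1
  refine List.map_congr_left fun A _ => ?_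
  cases A with
  | delta v =>
    obtain ⟨c, u⟩ := v
    cases c
    · have := t.2
      rw [if_neg (show ¬ (Summand.delta (.x, u)).yStart ≤ t by simp only [Summand.yStart]; omega)]
      simp [Summand.weight]
    · simp [Summand.yStart, Summand.weight]
  | E i j => simp [Summand.yStart, Summand.weight]

theorem exists_staircase_summand {δ : Vertex s → ℕ} {E : Fin s → Fin s → ModuleCat.{u} (NAlg k s)}
    (hE : ∀ i j : Fin s, j < i → IsE k s i j (E i j)) {A : Summand s} (hA : A ∈ greedy [] δ) :
    letI := fieldModule k s (summandModule E A)
    ∃ β : A2 → ℕ → summandModule E A, Staircase k s A.xStart A.yStart β := by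
  cases A with
  | delta v =>
    let := fieldModule k s (summandModule E (.delta v))
    have := isScalarTower_fieldModule (k := k) (s := s) (summandModule E (.delta v))
    obtain ⟨β, hβ⟩ := exists_staircase_standard (k := k) v
    let e : Δ k s v ≃ₗ[NAlg k s] summandModule E (.delta v) := LinearEquiv.refl (NAlg k s) (Δ k s v)
    exact ⟨_, hβ.map_equiv e⟩
  | E i j =>
    have hji := (greedyRun_greedy δ).lt_of_E_mem hA
    let := fieldModule k s (summandModule E (.E i j))
    have := isScalarTower_fieldModule (k := k) (s := s) (summandModule E (.E i j))
    exact IsE.exists_staircase (M := summandModule E (.E i j)) hji (hE i j hji)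

theorem dimVec_summand {δ : Vertex s → ℕ} {E : Fin s → Fin s → ModuleCat.{u} (NAlg k s)}
    (hE : ∀ i j : Fin s, j < i → IsE k s i j (E i j)) {A : Summand s} (hA : A ∈ greedy [] δ)
    (v : Vertex s) :
    dimVec k s (summandModule E A) v = A.weight fun w => dimVec k s (Δ k s w) v := by
  cases A with
  | delta w => rfl
  | E i j =>
    have hji := (greedyRun_greedy δ).lt_of_E_mem hA
    refine ((hE i j hji).2.2.2 v).trans ?_
    simp [add_mul, Finset.sum_add_distrib, Pi.single_apply, Summand.weight]

theorem isDeltaFiltered_summand {δ : Vertex s → ℕ}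
    {E : Fin s → Fin s → ModuleCat.{u} (NAlg k s)}
    (hE : ∀ i j : Fin s, j < i → IsE k s i j (E i j)) {A : Summand s} (hA : A ∈ greedy [] δ) :
    IsDeltaFiltered k s (summandModule E A) := by
  cases A with
  | delta w => exact isDeltaFiltered_standard w
  | E i j =>
    have hji := (greedyRun_greedy δ).lt_of_E_mem hA
    exact (hE i j hji).2.1

theorem output_properties {d δ : Vertex s → ℕ} (hδ : IsDeltaDimVec k s d δ)
    {E : Fin s → Fin s → ModuleCat.{u} (NAlg k s)}
    (hE : ∀ i j : Fin s, j < i → IsE k s i j (E i j)) :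
    IsFiniteDimensional k s (Output E δ) ∧ dimVec k s (Output E δ) = d ∧
      IsDeltaFiltered k s (Output E δ) ∧ IsRigid k s (Output E δ) := by
  let L := greedy [] δ
  have hmem : ∀ n : Fin L.length, L.get n ∈ greedy [] δ := fun n => List.get_mem _ _
  let X : Fin L.length → Type u := fun n => summandModule E (L.get n)
  let : ∀ n, Module k (X n) := fun n => fieldModule k s (X n)
  have : ∀ n, IsScalarTower k (NAlg k s) (X n) := fun n => isScalarTower_fieldModule (X n)
  choose β hβ using fun n => exists_staircase_summand hE (hmem n)
  have hfin : ∀ n, Module.Finite k (X n) := fun n => (hβ n).finite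
  refine ⟨(isFiniteDimensional_iff (M := ∀ n, X n)).2 inferInstance, ?_,
    IsDeltaFiltered.pi fun n => isDeltaFiltered_summand hE (hmem n),
    isRigid_pi (X := X) hβ (fun n => Summand.valid_of_mem (hmem n))
      (fun n => Summand.xStart_ne _)
      fun n m => (greedyRun_greedy δ).orthogonal _ (hmem n) _ (hmem m)⟩
  ext v
  refine (dimVec_pi (X := X) v).trans ?_
  rw [hδ v, ← (greedyRun_greedy δ).sum_weight fun w => dimVec k s (Δ k s w) v, ← sum_get_eq]
  exact Finset.sum_congr rfl fun n _ => dimVec_summand hE (hmem n) v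

/-- Basis vectors are indexed by the positions in the greedy list that have an `x`-part,
respectively a `y`-part. The counts of starting layers match the dimensions of the flag, so adapted
bases with these indices exist. -/
theorem hasRichardsonOrbit [NeZero s] [Infinite k] {d δ : Vertex s → ℕ}
    (hδ : IsDeltaDimVec k s d δ) {F : Flags k d} (hF : IsFlag d F) : HasRichardsonOrbit d F := by
  have hrun := greedyRun_greedy δ
  set L := greedy [] δ
  have hmem : ∀ n : Fin L.length, L.get n ∈ greedy [] δ := fun n => List.get_mem _ _
  have hd := isDeltaDimVec_iff.1 hδ
  have htop : ∀ c, F c ⊤ = ⊤ := fun c => Submodule.eq_top_of_finrank_eq (by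
    rw [(hF c).2, Module.finrank_fin_fun])
  have hcard : ∀ (f : Fin L.length → ℕ) (t : Fin s),
      (Finset.univ.filter fun n : {n // f n < s} => (⟨f n.1, n.2⟩ : Fin s) ≤ t).card =
        (Finset.univ.filter fun n => f n ≤ t).card := by
    intro f t
    refine Finset.card_bij (fun n _ => n.1) (fun n hn => ?_) (fun n _ m _ e => Subtype.ext e)
      (fun n hn => ?_)
    · simpa [Fin.le_def] using hn
    · have : f n ≤ t := by simpa using hn
      exact ⟨⟨n, this.trans_lt t.2⟩, by simpa [Fin.le_def] using this, rfl⟩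
  obtain ⟨v, hv⟩ := exists_adapted_basis (F .x) (hF .x).1 (htop .x)
    (fun n : {n : Fin L.length // (L.get n).xStart < s} => (⟨(L.get n.1).xStart, n.2⟩ : Fin s))
    (fun t => by
      rw [hcard fun n => (L.get n).xStart, (hF .x).2, hd, card_xStart_le L hrun])
  obtain ⟨w, hw⟩ := exists_adapted_basis (F .y) (hF .y).1 (htop .y)
    (fun n : {n : Fin L.length // (L.get n).yStart < s} => (⟨(L.get n.1).yStart, n.2⟩ : Fin s))
    (fun t => by
      rw [hcard fun n => (L.get n).yStart, (hF .y).2, hd, card_yStart_le L hrun])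
  exact hasRichardsonOrbit_of_bases (p := fun n => (L.get n).xStart)
    (q := fun n => (L.get n).yStart)
    (fun n => Summand.valid_of_mem (hmem n))
    (fun n m => hrun.orthogonal _ (hmem n) _ (hmem m)) v w hv hw

end Output

end NilpA2

theorem mainTheorem11 (k : Type u) [Field k] (s : ℕ) [NeZero s] :
    (∀ i j : Fin s, j < i →
      ∃ E : ModuleCat.{u} (NilpA2.NAlg k s), NilpA2.IsE k s i j E ∧
        ∀ E' : ModuleCat.{u} (NilpA2.NAlg k s), NilpA2.IsE k s i j E' →
          Nonempty (E' ≃ₗ[NilpA2.NAlg k s] E)) ∧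
    ∀ d : NilpA2.Vertex s → ℕ, NilpA2.IsDimFiltration d →
      (∃! δ : NilpA2.Vertex s → ℕ, NilpA2.IsDeltaDimVec k s d δ) ∧
      (∀ δ : NilpA2.Vertex s → ℕ, NilpA2.IsDeltaDimVec k s d δ →
        ∀ E : Fin s → Fin s → ModuleCat.{u} (NilpA2.NAlg k s),
          (∀ i j : Fin s, j < i → NilpA2.IsE k s i j (E i j)) →
            NilpA2.IsFiniteDimensional k s (NilpA2.Output E δ) ∧
            NilpA2.dimVec k s (NilpA2.Output E δ) = d ∧
            NilpA2.IsDeltaFiltered k s (NilpA2.Output E δ) ∧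
            NilpA2.IsRigid k s (NilpA2.Output E δ)) ∧
      (IsAlgClosed k → ∀ F : NilpA2.Flags k d, NilpA2.IsFlag d F →
        NilpA2.HasRichardsonOrbit d F) := by
  refine ⟨fun i j hji => NilpA2.exists_unique_E hji, fun d hd => ?_⟩
  have hex := NilpA2.existsUnique_isDeltaDimVec (k := k) hd
  refine ⟨hex, fun δ hδ E hE => NilpA2.output_properties hδ hE, fun _ F hF => ?_⟩
  obtain ⟨δ, hδ, -⟩ := hex
  have : Infinite k := IsAlgClosed.instInfinite
  exact NilpA2.hasRichardsonOrbit hδ hF
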